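/- Let $d\ge 1$. Write $\Omega=\{0,1,2,\dots,\infty\}^{\mathbb Z^d}$, where $\{0,1,2,\dots,\infty\}$ is the one-point compactification of the discrete space $\mathbb N$ and $\Omega$ has the product topology; probability measures on $\Omega$ are given the weak topology. Let $\mathsf{gcd}_\infty\in\Omega$ be the labelling $x\mapsto \gcd(x_1,\dots,x_d)$ (so $\mathsf{gcd}_\infty(0)=0$). For a nonempty finite set $S\subset\mathbb Z^d$, let $\mu_{S,\mathsf{gcd}_\infty}$ be the law of the labelling $x\mapsto \mathsf{gcd}_\infty(x+Y)$, where $Y$ is uniform in $S$. For an infinite subgroup $\Gamma$ of $\mathbb Z^d$, define the probability measure $\mu^\Gamma_{\infty,\mathsf{gcd}_\infty}$ on $\Omega$ as follows. For every prime $p$, set $\mathcal W^p_0=\mathbb Z^d$ and, for $n\ge 1$, conditionally on $(\mathcal W^p_0,\dots,\mathcal W^p_{n-1})$, let $\mathcal W^p_n$ be uniform among the cosets of $p^n\mathbb Z^d$ that lie inside $\mathcal W^p_{n-1}$ and intersect $\Gamma$; do this independently for the different primes. Put $V_p(x)=\sup\{n\ge 0: x\in \mathcal W^p_n\}\in\{0,1,\dots,\infty\}$.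 Then $\mu^\Gamma_{\infty,\mathsf{gcd}_\infty}$ is the law of $x\mapsto\prod_p p^{V_p(x)}$, where $p^\infty=\infty$ and the product is taken to be $0$ if $V_p(x)=\infty$ for all $p$. A sequence $(S_n)$ of nonempty finite subsets of $\Gamma$ is a Følner sequence for $\Gamma$ if $|S_n\,\Delta\,(S_n+y)|=o(|S_n|)$ for every $y\in\Gamma$. **Corollary.** Let $\Gamma$ be a subgroup of $\mathbb Z^d$ of rank $k\ge1$ which is maximal (for inclusion) among the subgroups of rank $k$. Let $F$ be a bounded subset of the real linear span of $\Gamma$ in $\mathbb R^d$ and, for $r\in(0,\infty)$, let $F_r=\{x\in\Gamma: r^{-1}x\in F\}$. Assume that $|F_r|/r^k$ converges to a nonzero limit as the real number $r$ tends to infinity, and that, for some integer $n_0\ge 1$, the sequence $(F_n)_{n\ge n_0}$ is a Følner sequence for $\Gamma$. Then $\mu_{F_n,\mathsf{gcd}_\infty}$ converges weakly to $\mu^\Gamma_{\infty,\mathsf{gcd}_\infty}$ as $n\to\infty$. -/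

import Mathlib

open MeasureTheory ProbabilityTheory Filter Topology

noncomputable section

namespace GcdView

/-- The space `Ω_X = X^{ℤ^d}` of labellings of `ℤ^d` by elements of `X`; it carries the product
topology and the product σ-algebra. -/
abbrev Config (d : ℕ) (X : Type*) : Type _ := (Fin d → ℤ) → X

/-- The translation `(τ_y ω)_x = ω_{x - y}`. -/
def shift {d : ℕ} {X : Type*} (y : Fin d → ℤ) (ω : Config d X) : Config d X :=
  fun x => ω (x - y)

/-- The labelling `gcd_∞`, with values in `ℕ∞ = {0, 1, 2, …, ∞}` (note that `gcd_∞ 0 = 0`). -/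
def gcdInfty (d : ℕ) : Config d ℕ∞ :=
  fun x => ((Finset.univ.gcd fun i => (x i).natAbs : ℕ) : ℕ∞)

/-- The measure `μ_{F,c}`: the law of `τ_{-Y} c` for `Y` uniform in the finite nonempty set `F`. -/
def viewMeasure {d : ℕ} {X : Type*} [MeasurableSpace X] (F : Set (Fin d → ℤ)) (hfin : F.Finite)
    (hne : F.Nonempty) (c : Config d X) : ProbabilityMeasure (Config d X) :=
  ⟨(uniformOn F).map fun Y => shift (-Y) c, by
    have := isProbabilityMeasure_uniformOn hfin hne
    exact Measure.isProbabilityMeasure_map (measurable_of_countable _).aemeasurable⟩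

/-- `(S n)` is a Følner sequence for `Γ`: a sequence of nonempty finite subsets of `Γ` such that
`|S n Δ (S n + y)| = o(|S n|)` for every `y ∈ Γ`. -/
structure IsFolner {d : ℕ} (Γ : AddSubgroup (Fin d → ℤ)) (S : ℕ → Set (Fin d → ℤ)) : Prop where
  subset : ∀ n, S n ⊆ Γ
  finite : ∀ n, (S n).Finite
  nonempty : ∀ n, (S n).Nonempty
  isLittleO : ∀ y ∈ Γ,
    (fun n => ((symmDiff (S n) ((fun x => x + y) '' S n)).ncard : ℝ)) =o[atTop]
      fun n => ((S n).ncard : ℝ)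

/-- The inclusion `ℤ^d → ℝ^d`. -/
def toReal {d : ℕ} (x : Fin d → ℤ) : Fin d → ℝ := fun i => (x i : ℝ)

/-- The set `F_r = {x ∈ Γ : r⁻¹ x ∈ F}`. -/
def dilate {d : ℕ} (Γ : AddSubgroup (Fin d → ℤ)) (F : Set (Fin d → ℝ)) (r : ℝ) :
    Set (Fin d → ℤ) :=
  {x | x ∈ Γ ∧ r⁻¹ • toReal x ∈ F}

/-- The real linear span of `Γ` in `ℝ^d`. -/
def realSpan {d : ℕ} (Γ : AddSubgroup (Fin d → ℤ)) : Submodule ℝ (Fin d → ℝ) :=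
  Submodule.span ℝ (toReal '' (Γ : Set (Fin d → ℤ)))

/-- The coset `y + m ℤ^d`. -/
def coset {d : ℕ} (m : ℕ) (y : Fin d → ℤ) : Set (Fin d → ℤ) :=
  {x | ∀ i, (m : ℤ) ∣ x i - y i}

/-- The cosets of `m ℤ^d` in `ℤ^d` that intersect `Γ`. -/
def CosetMeeting {d : ℕ} (Γ : AddSubgroup (Fin d → ℤ)) (m : ℕ) : Type :=
  {W : Set (Fin d → ℤ) // (∃ y, W = coset m y) ∧ (W ∩ (Γ : Set (Fin d → ℤ))).Nonempty}

instance {d : ℕ} (Γ : AddSubgroup (Fin d → ℤ)) (m : ℕ) : MeasurableSpace (CosetMeeting Γ m) := ⊤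

instance {d : ℕ} (Γ : AddSubgroup (Fin d → ℤ)) (m : ℕ) :
    DiscreteMeasurableSpace (CosetMeeting Γ m) := ⟨fun _ => trivial⟩

theorem self_mem_coset {d : ℕ} (m : ℕ) (y : Fin d → ℤ) : y ∈ coset m y := by
  intro i; simp

instance {d : ℕ} (Γ : AddSubgroup (Fin d → ℤ)) (p : Nat.Primes) (n : ℕ) :
    Finite (CosetMeeting Γ ((p : ℕ) ^ n)) := by
  have : NeZero ((p : ℕ) ^ n) := ⟨pow_ne_zero _ p.2.ne_zero⟩
  refine Finite.of_injective
    (fun W : CosetMeeting Γ ((p : ℕ) ^ n) =>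
      fun i => ((Classical.choose W.2.1 i : ℤ) : ZMod ((p : ℕ) ^ n))) ?_
  intro W W' h
  have hW := Classical.choose_spec W.2.1
  have hW' := Classical.choose_spec W'.2.1
  refine Subtype.ext (hW.trans (Eq.trans ?_ hW'.symm))
  ext x
  refine forall_congr' fun i => ?_
  have hi : ((Classical.choose W.2.1 i : ℤ) : ZMod ((p : ℕ) ^ n)) =
    (Classical.choose W'.2.1 i : ℤ) := congrFun h i
  rw [← ZMod.intCast_zmod_eq_zero_iff_dvd, ← ZMod.intCast_zmod_eq_zero_iff_dvd,
    Int.cast_sub, Int.cast_sub, hi]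

/-- The coset `0 + m ℤ^d`, which intersects `Γ`. For `m = 1` this is `ℤ^d`. -/
def zeroCoset {d : ℕ} (Γ : AddSubgroup (Fin d → ℤ)) (m : ℕ) : CosetMeeting Γ m :=
  ⟨coset m 0, ⟨0, rfl⟩, ⟨0, self_mem_coset m 0, Γ.zero_mem⟩⟩

/-- Given a coset `W` of `p ^ n ℤ^d`, the cosets of `p ^ (n + 1) ℤ^d` that lie inside `W` and
intersect `Γ`. -/
def subcosets {d : ℕ} (Γ : AddSubgroup (Fin d → ℤ)) (p : Nat.Primes) (n : ℕ)
    (W : CosetMeeting Γ ((p : ℕ) ^ n)) : Set (CosetMeeting Γ ((p : ℕ) ^ (n + 1))) :=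
  {W' | W'.1 ⊆ W.1}

theorem subcosets_nonempty {d : ℕ} (Γ : AddSubgroup (Fin d → ℤ)) (p : Nat.Primes) (n : ℕ)
    (W : CosetMeeting Γ ((p : ℕ) ^ n)) : (subcosets Γ p n W).Nonempty := by
  obtain ⟨W, ⟨y, rfl⟩, z, hz, hzΓ⟩ := W
  refine ⟨⟨coset ((p : ℕ) ^ (n + 1)) z, ⟨z, rfl⟩, z, self_mem_coset _ z, hzΓ⟩, ?_⟩
  intro x hx i
  have h1 : (((p : ℕ) ^ n : ℕ) : ℤ) ∣ x i - z i :=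
    (Int.natCast_dvd_natCast.2 (pow_dvd_pow _ n.le_succ)).trans (hx i)
  have h2 := dvd_add h1 (hz i)
  rwa [sub_add_sub_cancel] at h2

/-- The transition kernel: conditionally on `(W_0, …, W_n)`, pick `W_{n+1}` uniformly among the
cosets of `p ^ (n + 1) ℤ^d` that lie inside `W_n` and intersect `Γ`. -/
def stepKernel {d : ℕ} (Γ : AddSubgroup (Fin d → ℤ)) (p : Nat.Primes) (n : ℕ) :
    Kernel ((i : Finset.Iic n) → CosetMeeting Γ ((p : ℕ) ^ (i : ℕ)))
      (CosetMeeting Γ ((p : ℕ) ^ (n + 1))) where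
  toFun h := uniformOn (subcosets Γ p n (h ⟨n, Finset.mem_Iic.2 le_rfl⟩))
  measurable' := measurable_of_countable _

instance {d : ℕ} (Γ : AddSubgroup (Fin d → ℤ)) (p : Nat.Primes) (n : ℕ) :
    IsMarkovKernel (stepKernel Γ p n) :=
  ⟨fun _ => isProbabilityMeasure_uniformOn (Set.toFinite _) (subcosets_nonempty Γ p n _)⟩

/-- The law of the random sequence of nested cosets `(W_n^p)_{n ≥ 0}` started at
`W_0^p = ℤ^d`. -/
def chainLaw {d : ℕ} (Γ : AddSubgroup (Fin d → ℤ)) (p : Nat.Primes) :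
    Measure ((n : ℕ) → CosetMeeting Γ ((p : ℕ) ^ n)) :=
  Kernel.traj (X := fun n => CosetMeeting Γ ((p : ℕ) ^ n)) (stepKernel Γ p) 0
    fun i => zeroCoset Γ ((p : ℕ) ^ (i : ℕ))

instance {d : ℕ} (Γ : AddSubgroup (Fin d → ℤ)) (p : Nat.Primes) :
    IsProbabilityMeasure (chainLaw Γ p) := by
  unfold chainLaw; infer_instance

/-- All the random sequences of cosets, one for each prime. -/
abbrev Chains {d : ℕ} (Γ : AddSubgroup (Fin d → ℤ)) : Type :=
  (p : Nat.Primes) → (n : ℕ) → CosetMeeting Γ ((p : ℕ) ^ n)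

/-- The random sequences of cosets are chosen independently for the different primes. -/
def chainsLaw {d : ℕ} (Γ : AddSubgroup (Fin d → ℤ)) : Measure (Chains Γ) :=
  Measure.infinitePi fun p => chainLaw Γ p

instance {d : ℕ} (Γ : AddSubgroup (Fin d → ℤ)) : IsProbabilityMeasure (chainsLaw Γ) := by
  unfold chainsLaw; infer_instance

open Classical in
/-- The random valuation `V_p(x) = sup {n : x ∈ W_n^p}`. -/
def valuation {d : ℕ} {Γ : AddSubgroup (Fin d → ℤ)} (W : Chains Γ) (p : Nat.Primes)
    (x : Fin d → ℤ) : ℕ∞ :=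
  ⨆ n : ℕ, if x ∈ (W p n).1 then (n : ℕ∞) else 0

open Classical in
/-- The random gcd profile `x ↦ ∏_p p ^ V_p(x)`, with `p ^ ∞ = ∞`. The infinite product, all of
whose factors are at least `1`, is the supremum of the finite products. By convention, the
product is `0` if all the valuations are infinite. -/
def gcdProfile {d : ℕ} {Γ : AddSubgroup (Fin d → ℤ)} (W : Chains Γ) : Config d ℕ∞ :=
  fun x =>
    if ∀ p, valuation W p x = ⊤ then 0
    else ⨆ s : Finset Nat.Primes, ∏ p ∈ s, ((p : ℕ) : ℕ∞) ^ valuation W p x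

instance : BorelSpace ℕ∞ := by
  refine ⟨le_antisymm (fun s _ => ?_) le_top⟩
  have : @MeasurableSet ℕ∞ (borel ℕ∞) s := by
    let _ : MeasurableSpace ℕ∞ := borel ℕ∞
    have : BorelSpace ℕ∞ := ⟨rfl⟩
    exact s.to_countable.measurableSet
  exact this

open Classical in
theorem measurable_valuation {d : ℕ} (Γ : AddSubgroup (Fin d → ℤ)) (p : Nat.Primes)
    (x : Fin d → ℤ) : Measurable fun W : Chains Γ => valuation W p x := by
  unfold valuation
  refine Measurable.iSup fun n => ?_
  have h : Measurable fun W : Chains Γ => W p n :=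
    (measurable_pi_apply n).comp (measurable_pi_apply p)
  exact (Measurable.of_discrete (f := fun c : CosetMeeting Γ ((p : ℕ) ^ n) =>
    if x ∈ c.1 then (n : ℕ∞) else 0)).comp h

theorem measurable_gcdProfile {d : ℕ} (Γ : AddSubgroup (Fin d → ℤ)) :
    Measurable fun W : Chains Γ => gcdProfile W := by
  refine measurable_pi_lambda _ fun x => ?_
  unfold gcdProfile
  refine Measurable.ite ?_ measurable_const (Measurable.iSup fun s => ?_)
  · rw [Set.ofPred_forall]
    exact MeasurableSet.iInter fun p =>
      measurable_valuation Γ p x (MeasurableSet.singleton (⊤ : ℕ∞))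
  · refine Finset.measurable_prod s fun p _ => ?_
    exact (Measurable.of_discrete (f := fun v : ℕ∞ => ((p : ℕ) : ℕ∞) ^ v)).comp
      (measurable_valuation Γ p x)

/-- The measure `μ^Γ_{∞,gcd_∞}`: the law of the random gcd profile. -/
def limitMeasure {d : ℕ} (Γ : AddSubgroup (Fin d → ℤ)) : ProbabilityMeasure (Config d ℕ∞) :=
  ⟨(chainsLaw Γ).map gcdProfile,
    Measure.isProbabilityMeasure_map (measurable_gcdProfile Γ).aemeasurable⟩

end GcdView

end

/-! Seen from a point `y` of `Γ`, the gcd labelling is the profile of the deterministic chains of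
cosets around `-y` (`gcdProfile_chainAt`). Both measures are thus laws of `gcdProfile`, and chains
at a uniform point of `F_n` are to be compared with random ones.

Maximality makes `Γ` a direct summand of `ℤ^d` (`exists_chart`), so every coset has `p ^ k` children
and `W_n^p` is uniform among `p ^ (n k)` cosets. A profile cut to primes below `N` and exponents at
most `N` depends on finitely many residues. By the Chinese remainder theorem, translations by `Γ`
act transitively on these, so the Følner property makes them asymptotically uniform
(`IsFolner.tendsto_truncProfile`).

The truncation is then removed at each site `x`. If `x ∉ Γ`, the gcd of `x + y` divides a fixed
nonzero vector (`tightAt_of_notMem`). If `x ∈ Γ` and `k ≥ 2`, a box of size `M` has at most `(3M)^k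
/ Q` points with gcd above `Q`, while `|F_n|` has order `n^k` (`tightAt_of_mem`). If `x ∈ Γ` and `k
= 1`, divergence of `∑ 1/p` makes the random product infinite (`ae_natCast_le_valuationProd`), and
large truncated products force large gcds. Boolean combinations of the events `{a ≤ ω x}` then
suffice for weak convergence (`tendsto_of_forall_le_mem`). -/

open scoped ENNReal

noncomputable section

namespace GcdView

/-! ### `Γ` as a direct summand of `ℤ^d` -/

/-- Coordinates on a rank `k` direct summand `Γ` of `ℤ^d`: an injection `ι : ℤ^k → ℤ^d` with image
`Γ`, together with a left inverse `π`. -/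
structure Chart {d : ℕ} (Γ : AddSubgroup (Fin d → ℤ)) (k : ℕ) where
  ι : (Fin k → ℤ) →ₗ[ℤ] (Fin d → ℤ)
  π : (Fin d → ℤ) →ₗ[ℤ] (Fin k → ℤ)
  π_ι : ∀ c, π (ι c) = c
  mem_iff : ∀ y, y ∈ Γ ↔ ι (π y) = y

/-- Adjoining `x` does not raise the rank: multiplication by `m` embeds `Γ + ℤx` back into `Γ`.
Maximality then absorbs `x`. -/
theorem mem_of_smul_mem_of_maximal {d k : ℕ} {Γ : AddSubgroup (Fin d → ℤ)}
    (hΓ : Maximal (fun H : AddSubgroup (Fin d → ℤ) => Module.finrank ℤ H = k) Γ)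
    {m : ℤ} (hm : m ≠ 0) {x : Fin d → ℤ} (hx : m • x ∈ Γ) : x ∈ Γ := by
  set H : AddSubgroup (Fin d → ℤ) := Γ ⊔ AddSubgroup.zmultiples x with hH
  have hle : Γ ≤ H := le_sup_left
  have hmul : ∀ h ∈ H, m • h ∈ Γ := by
    intro h hh
    obtain ⟨a, ha, b, hb, rfl⟩ := AddSubgroup.mem_sup.1 hh
    obtain ⟨n, rfl⟩ := AddSubgroup.mem_zmultiples_iff.1 hb
    rw [smul_add, smul_comm]
    exact Γ.add_mem (Γ.zsmul_mem ha m) (Γ.zsmul_mem hx n)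
  let Γ' := AddSubgroup.toIntSubmodule Γ
  let H' := AddSubgroup.toIntSubmodule H
  have h1 : Module.finrank ℤ Γ' ≤ Module.finrank ℤ H' :=
    Submodule.finrank_mono (show Γ' ≤ H' from hle)
  have h2 : Module.finrank ℤ H' ≤ Module.finrank ℤ Γ' := by
    let f : H' →ₗ[ℤ] Γ' :=
      LinearMap.codRestrict Γ' ((LinearMap.lsmul ℤ (Fin d → ℤ) m).comp H'.subtype)
        (fun h => hmul h.1 h.2)
    refine LinearMap.finrank_le_finrank_of_injective (f := f) ?_
    intro a b hab
    have : m • (a : Fin d → ℤ) = m • (b : Fin d → ℤ) := congrArg Subtype.val hab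
    exact Subtype.ext (smul_right_injective _ hm this)
  have h3 : Module.finrank ℤ H = k := by
    have := le_antisymm h2 h1
    exact this.trans hΓ.prop
  exact hΓ.le_of_ge h3 hle (AddSubgroup.mem_sup_right (AddSubgroup.mem_zmultiples x))

/-- `ℤ^d / Γ` is torsion-free, hence free, so the quotient map has a section `s`; subtracting `s` of
the class projects `ℤ^d` onto `Γ`. -/
theorem exists_chart {d k : ℕ} {Γ : AddSubgroup (Fin d → ℤ)}
    (hΓ : Maximal (fun H : AddSubgroup (Fin d → ℤ) => Module.finrank ℤ H = k) Γ) :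
    Nonempty (Chart Γ k) := by
  let Γ' := AddSubgroup.toIntSubmodule Γ
  have htf : Module.IsTorsionFree ℤ ((Fin d → ℤ) ⧸ Γ') := by
    refine Module.IsTorsionFree.mk fun m hm a b hab => ?_
    have hm : m ≠ 0 := hm.ne_zero
    induction a using Submodule.Quotient.induction_on with | _ a
    induction b using Submodule.Quotient.induction_on with | _ b
    rw [Submodule.Quotient.eq]
    have h : m • (a - b) ∈ Γ' := by
      rw [smul_sub, ← Submodule.Quotient.eq]
      exact hab
    exact mem_of_smul_mem_of_maximal hΓ hm h
  have hfree : Module.Free ℤ ((Fin d → ℤ) ⧸ Γ') := inferInstance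
  obtain ⟨s, hs⟩ := Module.projective_lifting_property Γ'.mkQ LinearMap.id Γ'.mkQ_surjective
  have hfr : Module.finrank ℤ Γ' = k := hΓ.prop
  let b : Module.Basis (Fin k) ℤ Γ' := Module.finBasisOfFinrankEq ℤ Γ' hfr
  let ρ : (Fin d → ℤ) →ₗ[ℤ] Γ' := LinearMap.codRestrict Γ' (LinearMap.id - s.comp Γ'.mkQ) (by
    intro x
    rw [← Submodule.Quotient.mk_eq_zero]
    have := LinearMap.congr_fun hs (Γ'.mkQ x)
    simp only [LinearMap.comp_apply, LinearMap.id_apply] at this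
    change Γ'.mkQ (x - s (Γ'.mkQ x)) = 0
    rw [map_sub, this, sub_self])
  have hρ : ∀ y : Γ', ρ y = y := by
    intro y
    refine Subtype.ext ?_
    change (y : Fin d → ℤ) - s (Γ'.mkQ y) = y
    rw [(Submodule.Quotient.mk_eq_zero Γ').2 y.2 |> fun h => (show Γ'.mkQ y = 0 from h), map_zero,
      sub_zero]
  refine ⟨⟨Γ'.subtype.comp b.equivFun.symm.toLinearMap, b.equivFun.toLinearMap.comp ρ, ?_, ?_⟩⟩
  · intro c
    simp only [LinearMap.comp_apply, LinearEquiv.coe_coe, Submodule.subtype_apply, hρ,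
      LinearEquiv.apply_symm_apply]
  · intro y
    simp only [LinearMap.comp_apply, LinearEquiv.coe_coe, Submodule.subtype_apply,
      LinearEquiv.symm_apply_apply]
    constructor
    · intro hy
      exact congrArg Subtype.val (hρ ⟨y, hy⟩)
    · intro h
      rw [← h]
      exact (ρ y).2

theorem forall_dvd_iff {n : ℕ} {m : ℤ} {c : Fin n → ℤ} :
    (∀ i, m ∣ c i) ↔ ∃ c', c = m • c' := by
  constructor
  · intro h
    choose c' hc' using h
    exact ⟨c', funext hc'⟩
  · rintro ⟨c', rfl⟩ i
    exact Dvd.intro _ rfl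

theorem forall_dvd_map {n n' : ℕ} (f : (Fin n → ℤ) →ₗ[ℤ] (Fin n' → ℤ)) {m : ℤ} {c : Fin n → ℤ}
    (h : ∀ i, m ∣ c i) : ∀ i, m ∣ f c i := by
  obtain ⟨c', rfl⟩ := forall_dvd_iff.1 h
  rw [map_smul]
  exact forall_dvd_iff.2 ⟨_, rfl⟩

namespace Chart

variable {d k : ℕ} {Γ : AddSubgroup (Fin d → ℤ)} (e : Chart Γ k)
include e

theorem ι_mem (c : Fin k → ℤ) : e.ι c ∈ Γ := (e.mem_iff _).2 (by rw [e.π_ι])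

/-- Integer linear maps preserve divisibility, and `ι`, `π` are mutually inverse between `ℤ^k` and
`Γ`. Gcds on `Γ` can therefore be computed in coordinates. -/
theorem dvd_π_iff {z : Fin d → ℤ} (hz : z ∈ Γ) {m : ℤ} :
    (∀ j, m ∣ e.π z j) ↔ ∀ i, m ∣ z i := by
  refine ⟨fun h => ?_, forall_dvd_map e.π⟩
  rw [← (e.mem_iff z).1 hz]
  exact forall_dvd_map e.ι h

theorem dvd_ι_iff {c : Fin k → ℤ} {m : ℤ} : (∀ i, m ∣ e.ι c i) ↔ ∀ j, m ∣ c j := by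
  rw [← e.dvd_π_iff (e.ι_mem c), e.π_ι]

end Chart

/-! ### Counting the cosets that meet `Γ` -/

variable {d k : ℕ} {Γ : AddSubgroup (Fin d → ℤ)}

/-- The coset `y + m ℤ^d` of an element `y` of `Γ`. -/
def cosetOf (m : ℕ) (y : Γ) : CosetMeeting Γ m :=
  ⟨coset m y, ⟨y, rfl⟩, y, self_mem_coset m _, y.2⟩

theorem coset_subset_iff {m n : ℕ} (h : m ∣ n) {y z : Fin d → ℤ} :
    coset n y ⊆ coset m z ↔ ∀ i, (m : ℤ) ∣ y i - z i := by
  constructor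
  · intro hs
    exact hs (self_mem_coset n y)
  · intro hyz x hx i
    have := dvd_add ((Int.natCast_dvd_natCast.2 h).trans (hx i)) (hyz i)
    rwa [sub_add_sub_cancel] at this

theorem coset_eq_iff {m : ℕ} {y z : Fin d → ℤ} :
    coset m y = coset m z ↔ ∀ i, (m : ℤ) ∣ y i - z i := by
  constructor
  · intro h
    exact (coset_subset_iff dvd_rfl).1 h.subset
  · intro h
    refine ((coset_subset_iff dvd_rfl).2 h).antisymm ((coset_subset_iff dvd_rfl).2 fun i => ?_)
    rw [← neg_sub]
    exact (h i).neg_right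

theorem cosetOf_eq_iff {m : ℕ} {y z : Γ} :
    cosetOf m y = cosetOf m z ↔ ∀ i, (m : ℤ) ∣ (y : Fin d → ℤ) i - (z : Fin d → ℤ) i :=
  Subtype.ext_iff.trans coset_eq_iff

theorem exists_cosetOf {m : ℕ} (W : CosetMeeting Γ m) : ∃ y : Γ, cosetOf m y = W := by
  obtain ⟨W, ⟨y, rfl⟩, z, hz, hzΓ⟩ := W
  exact ⟨⟨z, hzΓ⟩, Subtype.ext (coset_eq_iff.2 hz)⟩

/-- The elements `z + ι (m c)`, with `c` running over `k`-tuples of residues mod `q`, represent each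
such coset once. -/
theorem Chart.ncard_cosets_subset (e : Chart Γ k) {m q M : ℕ} (hM : M = m * q) (hm : m ≠ 0)
    (hq : q ≠ 0) (z : Γ) : {W : CosetMeeting Γ M | W.1 ⊆ coset m z}.ncard = q ^ k := by
  have : NeZero q := ⟨hq⟩
  let f : (Fin k → ZMod q) → CosetMeeting Γ M := fun c =>
    cosetOf M (z + ⟨e.ι (fun j => (m : ℤ) * ((c j).val : ℤ)), e.ι_mem _⟩)
  have key : ∀ a b : Fin k → ℤ, (∀ i, (M : ℤ) ∣ e.ι (fun j => (m : ℤ) * a j) i -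
      e.ι (fun j => (m : ℤ) * b j) i) ↔ ∀ j, ((a j : ZMod q)) = b j := by
    intro a b
    have h : ∀ i, e.ι (fun j => (m : ℤ) * a j) i - e.ι (fun j => (m : ℤ) * b j) i =
        e.ι (fun j => (m : ℤ) * (a j - b j)) i := by
      intro i
      rw [← Pi.sub_apply, ← map_sub]
      refine congrFun (congrArg e.ι (funext fun j => ?_)) i
      simp [mul_sub]
    simp only [h]
    rw [e.dvd_ι_iff]
    refine forall_congr' fun j => ?_
    rw [hM, Nat.cast_mul, mul_dvd_mul_iff_left (by exact_mod_cast hm),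
      ← ZMod.intCast_zmod_eq_zero_iff_dvd, Int.cast_sub, sub_eq_zero]
  have hf : Function.Injective f := by
    intro a b hab
    have h := cosetOf_eq_iff.1 hab
    simp only [AddSubgroup.coe_add, Pi.add_apply, add_sub_add_left_eq_sub] at h
    have h' := (key _ _).1 h
    funext j
    simpa using h' j
  have hr : {W : CosetMeeting Γ M | W.1 ⊆ coset m z} = Set.range f := by
    ext W
    constructor
    · intro hW
      obtain ⟨y, rfl⟩ := exists_cosetOf W
      have h1 := (coset_subset_iff (hM ▸ dvd_mul_right m q)).1 hW
      have h2 : ∀ i, (m : ℤ) ∣ ((y - z : Γ) : Fin d → ℤ) i := h1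
      rw [← e.dvd_π_iff (y - z).2] at h2
      choose a ha using h2
      refine ⟨fun j => (a j : ZMod q), cosetOf_eq_iff.2 ?_⟩
      have h3 : (y : Fin d → ℤ) = z + e.ι (fun j => (m : ℤ) * a j) := by
        rw [← funext ha, (e.mem_iff _).1 (y - z).2]
        simp
      simp only [AddSubgroup.coe_add, Pi.add_apply, h3, add_sub_add_left_eq_sub]
      rw [key]
      intro j
      simp
    · rintro ⟨c, rfl⟩
      refine (coset_subset_iff (hM ▸ dvd_mul_right m q)).2 ?_
      simp only [AddSubgroup.coe_add, Pi.add_apply, add_sub_cancel_left]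
      rw [e.dvd_ι_iff]
      exact fun j => dvd_mul_right _ _
  rw [hr, ← Nat.card_coe_set_eq, Nat.card_range_of_injective hf, Nat.card_fun, Nat.card_zmod,
    Nat.card_eq_fintype_card, Fintype.card_fin]

theorem Chart.ncard_subcosets (e : Chart Γ k) (p : Nat.Primes) (n : ℕ)
    (W : CosetMeeting Γ ((p : ℕ) ^ n)) : (subcosets Γ p n W).ncard = (p : ℕ) ^ k := by
  obtain ⟨z, rfl⟩ := exists_cosetOf W
  exact e.ncard_cosets_subset (pow_succ _ _) (pow_ne_zero _ p.2.ne_zero) p.2.ne_zero z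

theorem Chart.card_cosetMeeting (e : Chart Γ k) {m : ℕ} (hm : m ≠ 0) :
    Nat.card (CosetMeeting Γ m) = m ^ k := by
  rw [← e.ncard_cosets_subset (one_mul m).symm one_ne_zero hm 0, ← Set.ncard_univ]
  congr 1
  ext W
  simp only [Set.mem_univ, Set.mem_ofPred_eq, true_iff]
  intro x _ i
  simp

/-! ### The law of the chain at one prime -/

open Classical in
theorem uniformOn_apply_singleton {Ω : Type*} [MeasurableSpace Ω] [DiscreteMeasurableSpace Ω]
    {s : Set Ω} (hs : s.Finite) (w : Ω) :
    uniformOn s {w} = if w ∈ s then ((s.ncard : ℝ≥0∞))⁻¹ else 0 := by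
  rw [uniformOn, cond_apply MeasurableSet.of_discrete, Measure.count_apply_finite s hs,
    Set.ncard_eq_toFinset_card s hs]
  split_ifs with h
  · rw [Set.inter_singleton_of_mem h, Measure.count_singleton, mul_one]
  · rw [Set.inter_singleton_eq_empty.2 h, measure_empty, mul_zero]

theorem uniformOn_compl_self {Ω : Type*} [MeasurableSpace Ω] [DiscreteMeasurableSpace Ω]
    (s : Set Ω) : uniformOn s sᶜ = 0 := by
  rw [uniformOn, cond_apply MeasurableSet.of_discrete]
  simp

/-- The Markov property. Keeping the whole past in the pair serves both nestedness and the one-step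
law. -/
theorem chainLaw_pair_apply (p : Nat.Primes) (n : ℕ)
    {s : Set (((i : Finset.Iic n) → CosetMeeting Γ ((p : ℕ) ^ (i : ℕ))) ×
      CosetMeeting Γ ((p : ℕ) ^ (n + 1)))} (hs : MeasurableSet s) :
    chainLaw Γ p {W | (Preorder.frestrictLe n W, W (n + 1)) ∈ s} =
      ∫⁻ W, uniformOn (subcosets Γ p n (W n)) (Prod.mk (Preorder.frestrictLe n W) ⁻¹' s)
        ∂chainLaw Γ p := by
  have h := Kernel.partialTraj_compProd_eq_map_traj
    (X := fun n => CosetMeeting Γ ((p : ℕ) ^ n)) (κ := stepKernel Γ p) (Nat.zero_le n)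
    (x₀ := fun i => zeroCoset Γ ((p : ℕ) ^ (i : ℕ)))
  have h' := congrArg (fun μ => μ s) h
  beta_reduce at h'
  rw [Measure.map_apply (by fun_prop) hs, Measure.compProd_apply hs,
    ← Kernel.traj_map_frestrictLe_apply, lintegral_map (Kernel.measurable_kernel_prodMk_left hs)
    (by fun_prop)] at h'
  exact h'.symm

theorem ae_nested_succ (p : Nat.Primes) (n : ℕ) :
    ∀ᵐ W ∂chainLaw Γ p, (W (n + 1)).1 ⊆ (W n).1 := by
  have h := chainLaw_pair_apply (Γ := Γ) p n
    (s := {x | ¬ x.2.1 ⊆ (x.1 ⟨n, Finset.mem_Iic.2 le_rfl⟩).1}) MeasurableSet.of_discrete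
  refine (h.trans ?_ : _)
  rw [lintegral_eq_zero_of_ae_eq_zero]
  refine Eventually.of_forall fun W => ?_
  exact uniformOn_compl_self (subcosets Γ p n (W n))

/-- A sequence of cosets is nested if it is decreasing. -/
def Nested {p : Nat.Primes} (W : (n : ℕ) → CosetMeeting Γ ((p : ℕ) ^ n)) : Prop :=
  ∀ n, (W (n + 1)).1 ⊆ (W n).1

theorem ae_nested (p : Nat.Primes) : ∀ᵐ W ∂chainLaw Γ p, Nested W :=
  ae_all_iff.2 (ae_nested_succ p)

/-- A coset of level `n + 1` has exactly one parent, and each parent has `p ^ k` equally likely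
children; the probabilities multiply. -/
theorem chainLaw_eval (e : Chart Γ k) (p : Nat.Primes) (n : ℕ)
    (w : CosetMeeting Γ ((p : ℕ) ^ n)) :
    chainLaw Γ p {W | W n = w} = ((((p : ℕ) ^ n) ^ k : ℕ) : ℝ≥0∞)⁻¹ := by
  induction n with
  | zero =>
    have hsub : Subsingleton (CosetMeeting Γ ((p : ℕ) ^ 0)) := by
      refine (Nat.card_eq_one_iff_unique.1 ?_).1
      rw [e.card_cosetMeeting (pow_ne_zero _ p.2.ne_zero)]
      simp
    have : {W : (n : ℕ) → CosetMeeting Γ ((p : ℕ) ^ n) | W 0 = w} = Set.univ :=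
      Set.eq_univ_of_forall fun W => Subsingleton.elim _ _
    rw [this, measure_univ]
    simp
  | succ n ih =>
    obtain ⟨y, rfl⟩ := exists_cosetOf w
    have h := chainLaw_pair_apply (Γ := Γ) p n (s := {x | x.2 = cosetOf ((p : ℕ) ^ (n + 1)) y})
      MeasurableSet.of_discrete
    refine (h.trans ?_ : _)
    have hint : ∀ W : (n : ℕ) → CosetMeeting Γ ((p : ℕ) ^ n),
        uniformOn (subcosets Γ p n (W n)) (Prod.mk (Preorder.frestrictLe n W) ⁻¹'
          {x | x.2 = cosetOf ((p : ℕ) ^ (n + 1)) y}) =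
        {W | W n = cosetOf ((p : ℕ) ^ n) y}.indicator
          (fun _ => (((p : ℕ) ^ k : ℕ) : ℝ≥0∞)⁻¹) W := by
      intro W
      refine (uniformOn_apply_singleton (Set.toFinite _) _).trans ?_
      rw [e.ncard_subcosets]
      classical
      rw [Set.indicator_apply]
      refine if_congr ?_ rfl rfl
      obtain ⟨z, hz⟩ := exists_cosetOf (W n)
      rw [Set.mem_ofPred_eq, ← hz, eq_comm, cosetOf_eq_iff]
      exact coset_subset_iff (pow_dvd_pow _ n.le_succ)
    simp_rw [hint]
    rw [lintegral_indicator, setLIntegral_const, ih, ← ENNReal.mul_inv]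
    · congr 1
      push_cast
      ring
    · simp
    · simp
    · exact (measurable_pi_apply n) (measurableSet_singleton _)

/-! ### Truncated profiles -/

/-- The primes smaller than `N`. -/
def primesLT (N : ℕ) : Finset Nat.Primes := (Finset.range N).subtype Nat.Prime

theorem mem_primesLT {N : ℕ} {p : Nat.Primes} : p ∈ primesLT N ↔ (p : ℕ) < N := by
  unfold primesLT
  exact Finset.mem_subtype.trans Finset.mem_range

theorem primesLT_mono : Monotone primesLT := fun _ _ h _ hp =>
  mem_primesLT.2 ((mem_primesLT.1 hp).trans_le h)

theorem exists_subset_primesLT (s : Finset Nat.Primes) : ∃ N, s ⊆ primesLT N := by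
  refine ⟨s.sup (fun p => (p : ℕ) + 1), fun p hp => mem_primesLT.2 ?_⟩
  exact Nat.lt_of_succ_le (Finset.le_sup (f := fun p : Nat.Primes => (p : ℕ) + 1) hp)

/-- The product `∏_p p ^ V_p(x)`, without the convention for the case of infinite valuations. -/
def valuationProd (W : Chains Γ) (x : Fin d → ℤ) : ℕ∞ :=
  ⨆ s : Finset Nat.Primes, ∏ p ∈ s, ((p : ℕ) : ℕ∞) ^ valuation W p x

/-- The truncated profile `∏_{p < N} p ^ min(V_p(x), N)`. -/
def truncProfile (N : ℕ) (W : Chains Γ) : Config d ℕ∞ :=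
  fun x => ∏ p ∈ primesLT N, ((p : ℕ) : ℕ∞) ^ min (valuation W p x) N

theorem prime_ne_zero (p : Nat.Primes) : ((p : ℕ) : ℕ∞) ≠ 0 := by
  exact_mod_cast p.2.ne_zero

theorem natCast_lt_prime_pow (p : Nat.Primes) (n : ℕ) : (n : ℕ∞) < ((p : ℕ) : ℕ∞) ^ (n : ℕ∞) := by
  rw [ENat.epow_natCast]
  exact_mod_cast Nat.lt_pow_self p.2.one_lt

theorem le_prime_pow (p : Nat.Primes) (v : ℕ∞) : v ≤ ((p : ℕ) : ℕ∞) ^ v := by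
  induction v with
  | top => rw [ENat.epow_top (by exact_mod_cast p.2.one_lt)]
  | coe n => exact (natCast_lt_prime_pow p n).le

theorem prod_prime_pow_mono {s t : Finset Nat.Primes} {v w : Nat.Primes → ℕ∞} (hst : s ⊆ t)
    (hvw : ∀ p ∈ s, v p ≤ w p) :
    ∏ p ∈ s, ((p : ℕ) : ℕ∞) ^ v p ≤ ∏ p ∈ t, ((p : ℕ) : ℕ∞) ^ w p :=
  (Finset.prod_le_prod' fun p hp => ENat.epow_right_mono (prime_ne_zero p) (hvw p hp)).trans
    (Finset.prod_le_prod_of_subset_of_one_le' hst fun p _ _ => ENat.one_le_epow (prime_ne_zero p))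

theorem truncProfile_mono (W : Chains Γ) (x : Fin d → ℤ) :
    Monotone fun N => truncProfile N W x := fun M N h =>
  prod_prime_pow_mono (primesLT_mono h) fun p _ => min_le_min le_rfl (by exact_mod_cast h)

theorem truncProfile_le_valuationProd (N : ℕ) (W : Chains Γ) (x : Fin d → ℤ) :
    truncProfile N W x ≤ valuationProd W x :=
  (prod_prime_pow_mono subset_rfl fun _ _ => min_le_left _ _).trans
    (le_iSup (fun s : Finset Nat.Primes => ∏ p ∈ s, ((p : ℕ) : ℕ∞) ^ valuation W p x) _)

theorem prime_pow_valuation_le (W : Chains Γ) (p : Nat.Primes) (x : Fin d → ℤ) :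
    ((p : ℕ) : ℕ∞) ^ valuation W p x ≤ valuationProd W x := by
  have := le_iSup (fun s : Finset Nat.Primes => ∏ p ∈ s, ((p : ℕ) : ℕ∞) ^ valuation W p x) {p}
  rwa [Finset.prod_singleton] at this

/-- Every factor satisfies `v ≤ p ^ v < N`, so no exponent is cut, and a prime `p ≥ N` must have
exponent `0`. -/
theorem truncProfile_eq_valuationProd {N : ℕ} {W : Chains Γ} {x : Fin d → ℤ}
    (h : valuationProd W x < N) : truncProfile N W x = valuationProd W x := by
  refine (truncProfile_le_valuationProd N W x).antisymm (iSup_le fun s => ?_)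
  have hlt : ∀ p : Nat.Primes, ((p : ℕ) : ℕ∞) ^ valuation W p x < N := fun p =>
    (prime_pow_valuation_le W p x).trans_lt h
  have hmin : ∀ p : Nat.Primes, min (valuation W p x) N = valuation W p x := fun p =>
    min_eq_left ((le_prime_pow p _).trans (hlt p).le)
  unfold truncProfile
  simp only [hmin]
  rw [← Finset.prod_filter_mul_prod_filter_not s (fun p : Nat.Primes => (p : ℕ) < N)]
  have h1 : ∏ p ∈ s.filter (fun p : Nat.Primes => ¬ (p : ℕ) < N), ((p : ℕ) : ℕ∞) ^ valuation W p x = 1 := by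
    refine Finset.prod_eq_one fun p hp => ?_
    by_contra hne
    have hv : valuation W p x ≠ 0 := fun h0 => hne (by rw [h0, ENat.epow_zero])
    have h2 : ((p : ℕ) : ℕ∞) ^ (1 : ℕ∞) ≤ ((p : ℕ) : ℕ∞) ^ valuation W p x :=
      ENat.epow_right_mono (prime_ne_zero p) (Order.one_le_iff_pos.2 (pos_iff_ne_zero.2 hv))
    rw [ENat.epow_one] at h2
    exact (Finset.mem_filter.1 hp).2 (Nat.cast_lt.1 (h2.trans_lt (hlt p)))
  rw [h1, mul_one]
  exact prod_prime_pow_mono (fun p hp => mem_primesLT.2 (Finset.mem_filter.1 hp).2)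
    fun _ _ => le_rfl

theorem exists_le_truncProfile {a : ℕ} {W : Chains Γ} {x : Fin d → ℤ}
    (h : (a : ℕ∞) ≤ valuationProd W x) : ∃ N, (a : ℕ∞) ≤ truncProfile N W x := by
  obtain htop | htop := eq_or_ne (valuationProd W x) ⊤
  · obtain ⟨s, hs⟩ := lt_iSup_iff.1 (htop ▸ ENat.natCast_lt_top a : (a : ℕ∞) < valuationProd W x)
    obtain ⟨N, hN⟩ := exists_subset_primesLT s
    -- A single infinite valuation already gives `p ^ N ≥ a` after truncation; otherwise `N` is
    -- taken above all the finite exponents over `s`.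
    by_cases hv : ∃ p ∈ s, valuation W p x = ⊤
    · obtain ⟨p, hp, hpv⟩ := hv
      refine ⟨max a N, ?_⟩
      have hp' : p ∈ primesLT (max a N) := primesLT_mono (le_max_right a N) (hN hp)
      refine le_trans ?_ (Finset.single_le_prod' (fun q _ => ENat.one_le_epow (prime_ne_zero q)) hp')
      rw [hpv, min_eq_right le_top]
      exact le_trans (by exact_mod_cast le_max_left a N) (le_prime_pow p _)
    · push Not at hv
      refine ⟨max (s.sup fun p => (valuation W p x).toNat) N, hs.le.trans ?_⟩
      refine prod_prime_pow_mono (hN.trans (primesLT_mono (le_max_right _ _))) fun p hp => ?_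
      refine le_min le_rfl ?_
      rw [← ENat.natCast_toNat (hv p hp)]
      exact_mod_cast (Finset.le_sup (f := fun p => (valuation W p x).toNat) hp).trans
        (le_max_left _ _)
  · obtain ⟨N, hN⟩ := ENat.ne_top_iff_exists.1 htop
    refine ⟨N + 1, ?_⟩
    rwa [truncProfile_eq_valuationProd]
    rw [← hN]
    exact_mod_cast N.lt_succ_self

theorem gcdProfile_eq_valuationProd {W : Chains Γ} {x : Fin d → ℤ}
    (h : ∃ p, valuation W p x ≠ ⊤) : gcdProfile W x = valuationProd W x := by
  unfold gcdProfile
  rw [if_neg (by push Not; exact h)]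
  rfl

theorem Nested.antitone {p : Nat.Primes} {W : (n : ℕ) → CosetMeeting Γ ((p : ℕ) ^ n)}
    (hW : Nested W) : Antitone fun n => (W n).1 :=
  antitone_nat_of_succ_le hW

theorem natCast_le_valuation_iff {W : Chains Γ} {p : Nat.Primes} (hW : Nested (W p)) {n : ℕ}
    {x : Fin d → ℤ} : (n : ℕ∞) ≤ valuation W p x ↔ x ∈ (W p n).1 := by
  classical
  constructor
  · intro h
    obtain rfl | hn := Nat.eq_zero_or_pos n
    · obtain ⟨y, hy⟩ := exists_cosetOf (W p 0)
      rw [← hy]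
      intro i
      simp
    -- A supremum above `n - 1` gives a level `m ≥ n` whose coset contains `x`; nesting brings this
    -- down to level `n`.
    · have hlt : ((n - 1 : ℕ) : ℕ∞) < valuation W p x :=
        lt_of_lt_of_le (by exact_mod_cast Nat.sub_lt hn one_pos) h
      obtain ⟨m, hm⟩ := lt_iSup_iff.1 hlt
      split_ifs at hm with hx
      · have : n - 1 < m := by exact_mod_cast hm
        exact hW.antitone (by omega : n ≤ m) hx
      · exact absurd hm not_lt_zero
  · intro h
    refine le_trans ?_ (le_iSup (fun n : ℕ => if x ∈ (W p n).1 then (n : ℕ∞) else 0) n)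
    rw [if_pos h]

theorem Nested.eq_of_eq {p : Nat.Primes} {W W' : (n : ℕ) → CosetMeeting Γ ((p : ℕ) ^ n)}
    (hW : Nested W) (hW' : Nested W') {N n : ℕ} (h : W N = W' N) (hn : n ≤ N) : W n = W' n := by
  obtain ⟨y, hy⟩ := exists_cosetOf (W N)
  obtain ⟨z, hz⟩ := exists_cosetOf (W n)
  obtain ⟨z', hz'⟩ := exists_cosetOf (W' n)
  have h1 : (W N).1 ⊆ (W n).1 := hW.antitone hn
  have h2 : (W N).1 ⊆ (W' n).1 := h ▸ hW'.antitone hn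
  rw [← hy, ← hz] at h1
  rw [← hy, ← hz'] at h2
  rw [← hz, ← hz', cosetOf_eq_iff.2 ((coset_subset_iff (pow_dvd_pow _ hn)).1 h1 : _) |>.symm,
    cosetOf_eq_iff.2 ((coset_subset_iff (pow_dvd_pow _ hn)).1 h2 : _) |>.symm]

/-- Levels above `N` are erased by the `min`, and in a nested chain the coset at level `N`
determines all earlier ones. -/
theorem truncProfile_congr {N : ℕ} {W W' : Chains Γ} (hW : ∀ p, Nested (W p))
    (hW' : ∀ p, Nested (W' p)) (h : ∀ p ∈ primesLT N, W p N = W' p N) :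
    truncProfile N W = truncProfile N W' := by
  funext x
  refine Finset.prod_congr rfl fun p hp => ?_
  congr 1
  refine ENat.eq_of_forall_natCast_le_iff fun n => ?_
  rw [le_min_iff, le_min_iff, natCast_le_valuation_iff (hW p), natCast_le_valuation_iff (hW' p)]
  refine and_congr_left fun hn => ?_
  rw [(hW p).eq_of_eq (hW' p) (h p hp) (by exact_mod_cast hn)]

/-! ### Chains centred at a lattice point -/

/-- The deterministic sequences of cosets around the point `-y`. -/
def chainAt (y : Γ) : Chains Γ := fun p n => cosetOf ((p : ℕ) ^ n) (-y)

theorem nested_chainAt (y : Γ) (p : Nat.Primes) : Nested (chainAt y p) := fun n =>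
  (coset_subset_iff (pow_dvd_pow _ n.le_succ)).2 fun i => by simp

/-- The gcd of the coordinates. -/
def gcdCoord (x : Fin d → ℤ) : ℕ := Finset.univ.gcd fun i => (x i).natAbs

theorem dvd_gcdCoord_iff {m : ℕ} {x : Fin d → ℤ} : m ∣ gcdCoord x ↔ ∀ i, (m : ℤ) ∣ x i := by
  unfold gcdCoord
  simp [Finset.dvd_gcd_iff, Int.natCast_dvd]

theorem gcdCoord_eq_zero_iff {x : Fin d → ℤ} : gcdCoord x = 0 ↔ x = 0 := by
  unfold gcdCoord
  simp [Finset.gcd_eq_zero_iff, funext_iff]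

/-- The centre `-y` is chosen so that membership of `x` means `p ^ n ∣ x + y` coordinatewise. -/
theorem natCast_le_valuation_chainAt {y : Γ} {p : Nat.Primes} {x : Fin d → ℤ} {n : ℕ} :
    (n : ℕ∞) ≤ valuation (chainAt y) p x ↔ (p : ℕ) ^ n ∣ gcdCoord (x + y.1) := by
  rw [natCast_le_valuation_iff (nested_chainAt y p), dvd_gcdCoord_iff]
  refine forall_congr' fun i => ?_
  simp

theorem valuation_chainAt {y : Γ} {x : Fin d → ℤ} (h : gcdCoord (x + y.1) ≠ 0) (p : Nat.Primes) :
    valuation (chainAt y) p x = padicValNat p (gcdCoord (x + y.1)) := by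
  have := Fact.mk p.2
  refine ENat.eq_of_forall_natCast_le_iff fun n => ?_
  rw [natCast_le_valuation_chainAt, padicValNat_dvd_iff_le h, Nat.cast_le]

theorem valuationProd_chainAt {y : Γ} {x : Fin d → ℤ} (h : gcdCoord (x + y.1) ≠ 0) :
    valuationProd (chainAt y) x = gcdCoord (x + y.1) := by
  have key : ∀ N, gcdCoord (x + y.1) < N →
      ∏ p ∈ primesLT N, ((p : ℕ) : ℕ∞) ^ valuation (chainAt y) p x = gcdCoord (x + y.1) := by
    intro N hN
    simp only [valuation_chainAt h, ENat.epow_natCast]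
    rw [← Nat.prod_pow_prime_padicValNat _ h N hN, Nat.cast_prod]
    simp only [Nat.cast_pow, Nat.prod_pow_prime_padicValNat _ h N hN]
    exact Finset.prod_subtype_eq_prod_filter
      (fun p : ℕ => (p : ℕ∞) ^ padicValNat p (gcdCoord (x + y.1)))
  refine le_antisymm (iSup_le fun s => ?_) ?_
  · obtain ⟨N, hN⟩ := exists_subset_primesLT s
    rw [← key (max N (gcdCoord (x + y.1) + 1)) (by simp)]
    exact prod_prime_pow_mono (hN.trans (primesLT_mono (le_max_left _ _))) fun _ _ => le_rfl
  · rw [← key (gcdCoord (x + y.1) + 1) (Nat.lt_succ_self _)]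
    exact le_iSup (fun s : Finset Nat.Primes =>
      ∏ p ∈ s, ((p : ℕ) : ℕ∞) ^ valuation (chainAt y) p x) _

theorem gcdProfile_chainAt_apply (y : Γ) (x : Fin d → ℤ) :
    gcdProfile (chainAt y) x = gcdCoord (x + y.1) := by
  -- At `x = -y` all valuations are infinite; the convention that the product is then `0` matches
  -- `gcd 0 = 0`.
  by_cases h : gcdCoord (x + y.1) = 0
  · have : ∀ p, valuation (chainAt y) p x = ⊤ := by
      intro p
      refine ENat.eq_top_iff_forall_ge.2 fun n => natCast_le_valuation_chainAt.2 ?_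
      rw [h]
      exact dvd_zero _
    unfold gcdProfile
    rw [if_pos this, h, Nat.cast_zero]
  · rw [gcdProfile_eq_valuationProd, valuationProd_chainAt h]
    refine ⟨⟨2, Nat.prime_two⟩, ?_⟩
    exact (valuation_chainAt h _).trans_ne (ENat.natCast_ne_top _)

theorem gcdProfile_chainAt (y : Γ) : gcdProfile (chainAt y) = shift (-y) (gcdInfty d) := by
  funext x
  rw [gcdProfile_chainAt_apply]
  unfold shift gcdInfty
  rw [AddSubgroup.coe_neg, sub_neg_eq_add]
  rfl

/-! ### Independence over primes and the Chinese remainder theorem -/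

theorem chainsLaw_cylinder (e : Chart Γ k) (s : Finset Nat.Primes) (N : ℕ)
    (w : (p : Nat.Primes) → CosetMeeting Γ ((p : ℕ) ^ N)) :
    chainsLaw Γ {W | ∀ p ∈ s, W p N = w p} = ∏ p ∈ s, ((((p : ℕ) ^ N) ^ k : ℕ) : ℝ≥0∞)⁻¹ := by
  have h := Measure.infinitePi_pi (μ := fun p => chainLaw Γ p) (s := s)
    (t := fun p => {W | W N = w p})
    (fun p _ => (measurable_pi_apply N) (measurableSet_singleton _))
  simp only [chainLaw_eval e] at h
  exact h

theorem ae_nested_chains : ∀ᵐ W ∂chainsLaw Γ, ∀ p, Nested (W p) := by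
  refine ae_all_iff.2 fun p => ?_
  have h := (measurePreserving_eval_infinitePi (fun p => chainLaw Γ p) p).quasiMeasurePreserving
  exact h.ae (ae_nested p)

/-- The Chinese remainder theorem, applied to each of the `k` coordinates, realises any finite
residue data by a single point of `Γ`. -/
theorem exists_chainAt_eq (e : Chart Γ k) (s : Finset Nat.Primes) (N : ℕ)
    (w : (p : Nat.Primes) → CosetMeeting Γ ((p : ℕ) ^ N)) :
    ∃ y : Γ, ∀ p ∈ s, chainAt y p N = w p := by
  choose z hz using fun p => exists_cosetOf (w p)
  have hne : ∀ p : Nat.Primes, (p : ℕ) ^ N ≠ 0 := fun p => pow_ne_zero _ p.2.ne_zero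
  have hcop : Set.Pairwise (s : Set Nat.Primes)
      (Function.onFun Nat.Coprime fun p : Nat.Primes => (p : ℕ) ^ N) := fun p _ q _ hpq =>
    Nat.Coprime.pow _ _ ((Nat.coprime_primes p.2 q.2).2 fun h => hpq (Subtype.ext h))
  let c : Fin k → ℤ := fun j => (Nat.chineseRemainderOfFinset
    (fun p : Nat.Primes => (e.π (z p) j % ((p : ℕ) ^ N : ℕ)).toNat) (fun p => (p : ℕ) ^ N) s
    (fun p _ => hne p) hcop : ℕ)
  have hc : ∀ p ∈ s, ∀ j, (((p : ℕ) ^ N : ℕ) : ℤ) ∣ c j - e.π (z p) j := by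
    intro p hp j
    have h := (Nat.chineseRemainderOfFinset
      (fun p : Nat.Primes => (e.π (z p) j % ((p : ℕ) ^ N : ℕ)).toNat) (fun p => (p : ℕ) ^ N) s
      (fun p _ => hne p) hcop).2 p hp
    have h' := (Nat.modEq_iff_dvd.1 h.symm)
    rw [Int.toNat_of_nonneg (Int.emod_nonneg _ (by exact_mod_cast hne p))] at h'
    have h2 := Int.emod_add_mul_ediv (e.π (z p) j) (((p : ℕ) ^ N : ℕ) : ℤ)
    have h3 := dvd_sub h' (dvd_mul_right (((p : ℕ) ^ N : ℕ) : ℤ)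
      (e.π (z p) j / (((p : ℕ) ^ N : ℕ) : ℤ)))
    rwa [sub_sub, h2] at h3
  refine ⟨-⟨e.ι c, e.ι_mem c⟩, fun p hp => ?_⟩
  rw [← hz p]
  unfold chainAt
  rw [neg_neg, cosetOf_eq_iff]
  have h : ∀ i, (((p : ℕ) ^ N : ℕ) : ℤ) ∣ (e.ι (c - e.π (z p))) i :=
    forall_dvd_map e.ι (hc p hp)
  rwa [map_sub, (e.mem_iff _).1 (z p).2] at h

/-! ### Equidistribution along Følner sequences -/

theorem uniformOn_real {Ω : Type*} [MeasurableSpace Ω] [DiscreteMeasurableSpace Ω]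
    {s : Set Ω} (hs : s.Finite) (t : Set Ω) :
    (uniformOn s).real t = ((s ∩ t).ncard : ℝ) / s.ncard := by
  rw [measureReal_def, uniformOn, cond_apply MeasurableSet.of_discrete,
    Measure.count_apply_finite s hs, Measure.count_apply_finite _ (hs.inter_of_left t),
    Set.ncard_eq_toFinset_card s hs, Set.ncard_eq_toFinset_card _ (hs.inter_of_left t)]
  simp [div_eq_inv_mul]

theorem IsFolner.isProbabilityMeasure {S : ℕ → Set (Fin d → ℤ)} (hS : IsFolner Γ S) (n : ℕ) :
    IsProbabilityMeasure (uniformOn (S n)) :=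
  isProbabilityMeasure_uniformOn (hS.finite n) (hS.nonempty n)

theorem IsFolner.tendsto_sub_translate {S : ℕ → Set (Fin d → ℤ)} (hS : IsFolner Γ S)
    {t : Fin d → ℤ} (ht : t ∈ Γ) (A : Set (Fin d → ℤ)) :
    Tendsto (fun n => (uniformOn (S n)).real {y | y + t ∈ A} - (uniformOn (S n)).real A) atTop
      (𝓝 0) := by
  refine squeeze_zero_norm (fun n => ?_) (hS.isLittleO t ht).tendsto_div_nhds_zero
  rw [uniformOn_real (hS.finite n), uniformOn_real (hS.finite n), ← sub_div, norm_div,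
    Real.norm_natCast]
  gcongr
  have hfin := hS.finite n
  set F := S n
  have hfin' : ((fun x => x + t) '' F).Finite := hfin.image _
  have hsd : (symmDiff F ((fun x => x + t) '' F)).Finite :=
    (hfin.union hfin').subset (fun x hx => hx.imp And.left And.left)
  -- Translating the test set amounts to translating `F`, so the two counts differ by at most the
  -- symmetric difference.
  have h1 : (F ∩ {y | y + t ∈ A}).ncard = ((fun x => x + t) '' F ∩ A).ncard := by
    rw [← Set.image_inter_preimage, Set.ncard_image_of_injective _ (add_left_injective t)]
    rfl
  have h2 : ((fun x => x + t) '' F ∩ A).ncard ≤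
      (F ∩ A).ncard + (symmDiff F ((fun x => x + t) '' F)).ncard := by
    refine (Set.ncard_le_ncard ?_ ((hfin.inter_of_left A).union hsd)).trans (Set.ncard_union_le _ _)
    intro x hx
    by_cases hF : x ∈ F
    · exact Or.inl ⟨hF, hx.2⟩
    · exact Or.inr (Or.inr ⟨hx.1, hF⟩)
  have h3 : (F ∩ A).ncard ≤ ((fun x => x + t) '' F ∩ A).ncard +
      (symmDiff F ((fun x => x + t) '' F)).ncard := by
    refine (Set.ncard_le_ncard ?_ ((hfin'.inter_of_left A).union hsd)).trans
      (Set.ncard_union_le _ _)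
    intro x hx
    by_cases hF : x ∈ (fun x => x + t) '' F
    · exact Or.inl ⟨hF, hx.2⟩
    · exact Or.inr (Or.inl ⟨hx.1, hF⟩)
  rw [h1, Real.norm_eq_abs, abs_le]
  have h2' : (((fun x => x + t) '' F ∩ A).ncard : ℝ) ≤
      (F ∩ A).ncard + (symmDiff F ((fun x => x + t) '' F)).ncard := by exact_mod_cast h2
  have h3' : ((F ∩ A).ncard : ℝ) ≤ ((fun x => x + t) '' F ∩ A).ncard +
      (symmDiff F ((fun x => x + t) '' F)).ncard := by exact_mod_cast h3
  constructor <;> linarith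

/-- Along a Følner sequence, a finite-valued function all of whose fibres are translates of each
other is asymptotically uniform. -/
theorem IsFolner.tendsto_fiber {S : ℕ → Set (Fin d → ℤ)} (hS : IsFolner Γ S) {E : Type*}
    [Fintype E] [Nonempty E] {Q : (Fin d → ℤ) → E}
    (hQ : ∀ w w', ∃ t ∈ Γ, ∀ y, Q (y + t) = w' ↔ Q y = w) (w : E) :
    Tendsto (fun n => (uniformOn (S n)).real (Q ⁻¹' {w})) atTop (𝓝 (Fintype.card E : ℝ)⁻¹) := by
  have hsum : ∀ n, ∑ w', (uniformOn (S n)).real (Q ⁻¹' {w'}) = 1 := by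
    intro n
    have := hS.isProbabilityMeasure n
    rw [sum_measureReal_preimage_singleton _ (fun _ _ => MeasurableSet.of_discrete)]
    simp
  have hdiff : ∀ w', Tendsto (fun n => (uniformOn (S n)).real (Q ⁻¹' {w}) -
      (uniformOn (S n)).real (Q ⁻¹' {w'})) atTop (𝓝 0) := by
    intro w'
    obtain ⟨t, ht, htQ⟩ := hQ w w'
    have := hS.tendsto_sub_translate ht (Q ⁻¹' {w'})
    have heq : {y | y + t ∈ Q ⁻¹' {w'}} = Q ⁻¹' {w} := Set.ext htQ
    rwa [heq] at this
  -- Summing over `w'` gives `|E|` times the mass of the fibre of `w`, minus `1`; adding `1` and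
  -- dividing by `|E|` isolates that mass.
  have hlim := ((tendsto_finsetSum Finset.univ fun w' _ => hdiff w').add_const 1).mul_const
    (Fintype.card E : ℝ)⁻¹
  simp only [Finset.sum_const_zero, zero_add, one_mul] at hlim
  refine hlim.congr fun n => ?_
  rw [Finset.sum_sub_distrib, hsum, Finset.sum_const, Finset.card_univ, nsmul_eq_mul,
    sub_add_cancel, mul_comm, ← mul_assoc, inv_mul_cancel₀, one_mul]
  exact_mod_cast Fintype.card_ne_zero

/-- Equal atoms make the law of `r` uniform on `E`, which is also the limit law of `Q`; summing over
`B` concludes. -/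
theorem IsFolner.tendsto_preimage {S : ℕ → Set (Fin d → ℤ)} (hS : IsFolner Γ S) {E : Type*}
    [Finite E] [Nonempty E] {Q : (Fin d → ℤ) → E}
    (hQ : ∀ w w', ∃ t ∈ Γ, ∀ y, Q (y + t) = w' ↔ Q y = w)
    {Ω : Type*} [MeasurableSpace Ω] {P : Measure Ω} [IsProbabilityMeasure P] {r : Ω → E}
    (hr : ∀ w, MeasurableSet (r ⁻¹' {w})) (hP : ∀ w w', P.real (r ⁻¹' {w}) = P.real (r ⁻¹' {w'}))
    (B : Set E) :
    Tendsto (fun n => (uniformOn (S n)).real (Q ⁻¹' B)) atTop (𝓝 (P.real (r ⁻¹' B))) := by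
  classical
  have := Fintype.ofFinite E
  have hB : (B : Set E) = (B.toFinset : Set E) := by simp
  have hPw : ∀ w, P.real (r ⁻¹' {w}) = (Fintype.card E : ℝ)⁻¹ := by
    intro w
    have h := sum_measureReal_preimage_singleton (μ := P) (Finset.univ : Finset E)
      (fun w _ => hr w)
    simp only [Finset.coe_univ, Set.preimage_univ, probReal_univ] at h
    rw [Finset.sum_congr rfl fun w' _ => hP w' w, Finset.sum_const, Finset.card_univ,
      nsmul_eq_mul] at h
    exact eq_inv_of_mul_eq_one_right h
  have h1 : ∀ n, (uniformOn (S n)).real (Q ⁻¹' B) =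
      ∑ w ∈ B.toFinset, (uniformOn (S n)).real (Q ⁻¹' {w}) := by
    intro n
    have := hS.isProbabilityMeasure n
    rw [sum_measureReal_preimage_singleton _ (fun _ _ => MeasurableSet.of_discrete), ← hB]
  have h2 : P.real (r ⁻¹' B) = ∑ w ∈ B.toFinset, P.real (r ⁻¹' {w}) := by
    rw [sum_measureReal_preimage_singleton _ (fun w _ => hr w), ← hB]
  simp only [h1, h2, hPw]
  exact tendsto_finsetSum _ fun w _ => hS.tendsto_fiber hQ w

/-- The projection of `ℤ^d` onto `Γ` given by a chart. -/
def Chart.proj (e : Chart Γ k) (y : Fin d → ℤ) : Γ := ⟨e.ι (e.π y), e.ι_mem _⟩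

theorem Chart.proj_add (e : Chart Γ k) (y z : Fin d → ℤ) :
    e.proj (y + z) = e.proj y + e.proj z := by
  refine Subtype.ext ?_
  simp [Chart.proj]

theorem Chart.coe_proj (e : Chart Γ k) {y : Fin d → ℤ} (hy : y ∈ Γ) :
    (e.proj y : Fin d → ℤ) = y := (e.mem_iff y).1 hy

theorem Chart.proj_coe (e : Chart Γ k) (y : Γ) : e.proj y = y := Subtype.ext (e.coe_proj y.2)

theorem chainAt_add_eq_iff {y z t : Γ} {p : Nat.Primes} {N : ℕ} :
    chainAt (y + t) p N = chainAt (z + t) p N ↔ chainAt y p N = chainAt z p N := by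
  unfold chainAt
  rw [cosetOf_eq_iff, cosetOf_eq_iff]
  refine forall_congr' fun i => ?_
  simp

/-- The truncated profile around a uniform point of a Følner sequence converges in total variation
to the truncated random profile. -/
theorem IsFolner.tendsto_truncProfile {S : ℕ → Set (Fin d → ℤ)} (hS : IsFolner Γ S)
    (e : Chart Γ k) (N : ℕ) (T : Set (Config d ℕ∞)) :
    Tendsto (fun n => (uniformOn (S n)).real {y | truncProfile N (chainAt (e.proj y)) ∈ T}) atTop
      (𝓝 ((chainsLaw Γ).real {W | truncProfile N W ∈ T})) := by
  let E := (p : primesLT N) → CosetMeeting Γ (((p : Nat.Primes) : ℕ) ^ N)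
  have hE : Finite E := Pi.finite
  let r : Chains Γ → E := fun W p => W p N
  have hE' : Nonempty E := ⟨r (chainAt 0)⟩
  classical
  let ext : E → (p : Nat.Primes) → CosetMeeting Γ ((p : ℕ) ^ N) := fun w p =>
    if h : p ∈ primesLT N then w ⟨p, h⟩ else zeroCoset Γ _
  have hext : ∀ W : Chains Γ, ∀ w, r W = w ↔ ∀ p ∈ primesLT N, W p N = ext w p := by
    intro W w
    constructor
    · rintro rfl p hp
      simp only [ext, dif_pos hp, r]
    · intro h
      funext p
      have := h p.1 p.2
      simp only [ext, dif_pos p.2] at this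
      exact this
  have hfib : ∀ w, r ⁻¹' {w} = {W | ∀ p ∈ primesLT N, W p N = ext w p} := fun w =>
    Set.ext fun W => hext W w
  -- Membership in `T` is read off from a nested representative of the residue data: an arbitrary
  -- chain with the same data need not be nested.
  let B : Set E := {w | ∃ y : Γ, r (chainAt y) = w ∧ truncProfile N (chainAt y) ∈ T}
  have key := hS.tendsto_preimage (Q := fun y => r (chainAt (e.proj y))) (P := chainsLaw Γ) (r := r)
    ?_ ?_ ?_ B
  · have h1 : {y | truncProfile N (chainAt (e.proj y)) ∈ T} =
        (fun y => r (chainAt (e.proj y))) ⁻¹' B := by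
      ext y
      refine ⟨fun h => ⟨_, rfl, h⟩, ?_⟩
      rintro ⟨z, hz, hzT⟩
      rwa [truncProfile_congr (nested_chainAt z) (nested_chainAt (e.proj y))
        (fun p hp => congrFun hz ⟨p, hp⟩)] at hzT
    have h2 : (chainsLaw Γ).real {W | truncProfile N W ∈ T} = (chainsLaw Γ).real (r ⁻¹' B) := by
      refine measureReal_congr ?_
      filter_upwards [ae_nested_chains] with W hW
      refine propext ⟨fun h => ?_, ?_⟩
      · obtain ⟨y, hy⟩ := exists_chainAt_eq e (primesLT N) N fun p => W p N
        refine ⟨y, funext fun p => hy p.1 p.2, ?_⟩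
        rwa [truncProfile_congr (nested_chainAt y) hW hy]
      · rintro ⟨z, hz, hzT⟩
        rwa [truncProfile_congr (nested_chainAt z) hW (fun p hp => congrFun hz ⟨p, hp⟩)] at hzT
    rw [h2]
    simpa only [h1] using key
  · intro w w'
    obtain ⟨a, ha⟩ := exists_chainAt_eq e (primesLT N) N (ext w)
    obtain ⟨b, hb⟩ := exists_chainAt_eq e (primesLT N) N (ext w')
    -- `a` and `b` realise `w` and `w'`, so translation by `b - a` carries one fibre to the other.
    refine ⟨(b - a : Γ), (b - a).2, fun y => ?_⟩
    rw [hext, hext]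
    refine forall₂_congr fun p hp => ?_
    rw [← ha p hp, ← hb p hp, e.proj_add, e.proj_coe]
    have := chainAt_add_eq_iff (y := e.proj y) (z := a) (t := b - a) (p := p) (N := N)
    rwa [add_sub_cancel] at this
  · intro w
    rw [hfib]
    have : {W : Chains Γ | ∀ p ∈ primesLT N, W p N = ext w p} =
        ⋂ p ∈ primesLT N, {W | W p N = ext w p} := by
      ext W
      simp
    rw [this]
    refine Finset.measurableSet_biInter _ fun p _ => ?_
    exact ((measurable_pi_apply N).comp (measurable_pi_apply p)) (measurableSet_singleton _)
  · intro w w'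
    rw [hfib, hfib, measureReal_def, measureReal_def, chainsLaw_cylinder e, chainsLaw_cylinder e]

/-! ### Almost sure properties of the random profile -/

theorem chainsLaw_eval (e : Chart Γ k) (p : Nat.Primes) (n : ℕ)
    (w : CosetMeeting Γ ((p : ℕ) ^ n)) :
    chainsLaw Γ {W | W p n = w} = ((((p : ℕ) ^ n) ^ k : ℕ) : ℝ≥0∞)⁻¹ := by
  have h := (measurePreserving_eval_infinitePi (fun p => chainLaw Γ p) p).measure_preimage
    (s := {W | W n = w}) ((measurable_pi_apply n) (measurableSet_singleton _)).nullMeasurableSet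
  rw [chainLaw_eval e] at h
  exact h

/-- The prime `2` suffices: at level `n` at most one coset contains `x`, and it has mass `2 ^ (-nk)
≤ 2 ^ (-n)`. So the convention for the value `0` almost surely plays no role in the limit. -/
theorem ae_exists_valuation_ne_top (e : Chart Γ k) (hk : 1 ≤ k) (x : Fin d → ℤ) :
    ∀ᵐ W ∂chainsLaw Γ, ∃ p, valuation W p x ≠ ⊤ := by
  let p : Nat.Primes := ⟨2, Nat.prime_two⟩
  have hbound : ∀ n : ℕ, chainsLaw Γ {W | x ∈ (W p n).1} ≤ ((2 : ℝ≥0∞)⁻¹) ^ n := by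
    intro n
    have h2 : ((((p : ℕ) ^ n) ^ k : ℕ) : ℝ≥0∞)⁻¹ ≤ ((2 : ℝ≥0∞)⁻¹) ^ n := by
      rw [← ENNReal.inv_pow, ENNReal.inv_le_inv]
      have : 2 ^ n ≤ ((p : ℕ) ^ n) ^ k := Nat.le_self_pow (by omega) _
      exact_mod_cast this
    by_cases hx : ∃ W : Chains Γ, x ∈ (W p n).1
    · obtain ⟨W₀, hW₀⟩ := hx
      refine le_trans (measure_mono fun W hW => ?_) ((chainsLaw_eval e p n (W₀ p n)).trans_le h2)
      obtain ⟨y, hy⟩ := exists_cosetOf (W p n)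
      obtain ⟨z, hz⟩ := exists_cosetOf (W₀ p n)
      change x ∈ (W p n).1 at hW
      change W p n = W₀ p n
      rw [← hy] at hW ⊢
      rw [← hz] at hW₀ ⊢
      exact Subtype.ext ((coset_eq_iff.2 hW).symm.trans (coset_eq_iff.2 hW₀))
    · have : {W : Chains Γ | x ∈ (W p n).1} = ∅ :=
        Set.eq_empty_of_forall_notMem fun W hW => hx ⟨W, hW⟩
      rw [this, measure_empty]
      exact zero_le
  have hnull : chainsLaw Γ {W | ∀ n, x ∈ (W p n).1} = 0 := by
    refine le_antisymm ?_ zero_le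
    refine ge_of_tendsto' (ENNReal.tendsto_pow_atTop_nhds_zero_of_lt_one
      (r := (2 : ℝ≥0∞)⁻¹) (by simp)) fun n => ?_
    exact (measure_mono (Set.ofPred_subset_ofPred.2 fun W hW => hW n)).trans (hbound n)
  filter_upwards [ae_nested_chains, measure_eq_zero_iff_ae_notMem.1 hnull] with W hW hWn
  refine ⟨p, fun htop => hWn fun n => ?_⟩
  rw [← natCast_le_valuation_iff (hW p), htop]
  exact le_top

/-- By `1 - t ≤ exp (-t)`, a bound `c > 0` would bound the sums of `1/p` over primes `p ≥ a` by
`-log c`, contradicting the divergence of `∑ 1/p`. -/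
theorem nonpos_of_le_prod_one_sub_inv_primes (a : ℕ) {c : ℝ}
    (hc : ∀ s : Finset Nat.Primes, (∀ p ∈ s, a ≤ (p : ℕ)) →
      c ≤ ∏ p ∈ s, (1 - 1 / ((p : ℕ) : ℝ))) : c ≤ 0 := by
  by_contra! hpos
  refine Nat.Primes.not_summable_one_div ?_
  have hfin : {p : Nat.Primes | (p : ℕ) < a}.Finite :=
    (primesLT a).finite_toSet.subset fun p hp => mem_primesLT.2 hp
  have hbd : ∀ s : Finset Nat.Primes, (∀ p ∈ s, a ≤ (p : ℕ)) →
      ∑ p ∈ s, 1 / ((p : ℕ) : ℝ) ≤ -Real.log c := by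
    intro s hs
    have h1 : ∏ p ∈ s, (1 - 1 / ((p : ℕ) : ℝ)) ≤ Real.exp (-∑ p ∈ s, 1 / ((p : ℕ) : ℝ)) := by
      rw [← Finset.sum_neg_distrib, Real.exp_sum]
      refine Finset.prod_le_prod (fun p _ => ?_) fun p _ => ?_
      · have : (1 : ℝ) ≤ (p : ℕ) := by exact_mod_cast p.2.one_lt.le
        have := div_le_one_of_le₀ this (by positivity)
        linarith
      · linarith [Real.add_one_le_exp (-(1 / ((p : ℕ) : ℝ)))]
    have h2 := (Real.log_le_iff_le_exp hpos).2 ((hc s hs).trans h1)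
    linarith
  refine summable_of_sum_le (c := -Real.log c + ∑ p ∈ primesLT a, 1 / ((p : ℕ) : ℝ))
    (fun p => by positivity) fun s => ?_
  classical
  have h3 : ∑ p ∈ s \ primesLT a, 1 / ((p : ℕ) : ℝ) ≤ -Real.log c := by
    refine hbd _ fun p hp => ?_
    have := (Finset.mem_sdiff.1 hp).2
    rw [mem_primesLT] at this
    omega
  calc ∑ p ∈ s, 1 / ((p : ℕ) : ℝ)
      ≤ ∑ p ∈ (s \ primesLT a) ∪ primesLT a, 1 / ((p : ℕ) : ℝ) := by
        refine Finset.sum_le_sum_of_subset_of_nonneg ?_ fun p _ _ => by positivity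
        rw [Finset.sdiff_union_self_eq_union]
        exact Finset.subset_union_left
    _ = ∑ p ∈ s \ primesLT a, 1 / ((p : ℕ) : ℝ) + ∑ p ∈ primesLT a, 1 / ((p : ℕ) : ℝ) :=
        Finset.sum_union Finset.sdiff_disjoint
    _ ≤ _ := by gcongr

/-- In rank one, `x ∈ W_1^p` has probability `1/p`, independently over `p`. Almost surely this
occurs for some `p ≥ a`, and that factor alone is at least `a`. -/
theorem ae_natCast_le_valuationProd (e : Chart Γ 1) {x : Fin d → ℤ} (hx : x ∈ Γ) (a : ℕ) :
    ∀ᵐ W ∂chainsLaw Γ, (a : ℕ∞) ≤ valuationProd W x := by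
  have hone : ∀ p : Nat.Primes, chainLaw Γ p {W | x ∈ (W 1).1}ᶜ =
      ENNReal.ofReal (1 - 1 / ((p : ℕ) : ℝ)) := by
    intro p
    have h1 : {W : (n : ℕ) → CosetMeeting Γ ((p : ℕ) ^ n) | x ∈ (W 1).1} =
        {W | W 1 = cosetOf _ ⟨x, hx⟩} := by
      ext W
      obtain ⟨y, hy⟩ := exists_cosetOf (W 1)
      rw [Set.mem_ofPred_eq, Set.mem_ofPred_eq, ← hy, eq_comm, cosetOf_eq_iff]
      rfl
    have hm : MeasurableSet {W : (n : ℕ) → CosetMeeting Γ ((p : ℕ) ^ n) |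
        W 1 = cosetOf _ ⟨x, hx⟩} := (measurable_pi_apply 1) (measurableSet_singleton _)
    have hp : (0 : ℝ) < ((p : ℕ) : ℝ) := by exact_mod_cast p.2.pos
    rw [h1, prob_compl_eq_one_sub hm, chainLaw_eval e, pow_one, pow_one,
      ENNReal.ofReal_sub _ (by positivity), ENNReal.ofReal_one, one_div,
      ENNReal.ofReal_inv_of_pos hp, ENNReal.ofReal_natCast]
  have hprod : ∀ s : Finset Nat.Primes, (chainsLaw Γ).real {W | ∀ p ∈ s, x ∉ (W p 1).1} =
      ∏ p ∈ s, (1 - 1 / ((p : ℕ) : ℝ)) := by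
    intro s
    have h := Measure.infinitePi_pi (μ := fun p => chainLaw Γ p) (s := s)
      (t := fun p => {W | x ∈ (W 1).1}ᶜ)
      (fun p _ => ((MeasurableSet.of_discrete
        (s := {w : CosetMeeting Γ ((p : ℕ) ^ 1) | x ∈ w.1})).preimage
          (measurable_pi_apply 1)).compl)
    simp only [hone] at h
    rw [← ENNReal.ofReal_prod_of_nonneg] at h
    · rw [measureReal_def]
      refine (congrArg ENNReal.toReal h).trans (ENNReal.toReal_ofReal ?_)
      refine Finset.prod_nonneg fun p _ => ?_
      have : (1 : ℝ) ≤ (p : ℕ) := by exact_mod_cast p.2.one_lt.le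
      have := div_le_one_of_le₀ this (by positivity)
      linarith
    · intro p _
      have : (1 : ℝ) ≤ (p : ℕ) := by exact_mod_cast p.2.one_lt.le
      have := div_le_one_of_le₀ this (by positivity)
      linarith
  have hnull : (chainsLaw Γ).real {W | ∀ p : Nat.Primes, a ≤ (p : ℕ) → x ∉ (W p 1).1} ≤ 0 := by
    refine nonpos_of_le_prod_one_sub_inv_primes a fun s hs => ?_
    rw [← hprod]
    exact measureReal_mono fun W hW p hp => hW p (hs p hp)
  have hnull' := (measureReal_eq_zero_iff).1 (hnull.antisymm measureReal_nonneg)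
  filter_upwards [ae_nested_chains, measure_eq_zero_iff_ae_notMem.1 hnull'] with W hW hWn
  have hWn' : ∃ p : Nat.Primes, a ≤ (p : ℕ) ∧ x ∈ (W p 1).1 := by
    by_contra! h
    exact hWn h
  obtain ⟨p, hp, hxp⟩ := hWn'
  rw [← natCast_le_valuation_iff (hW p)] at hxp
  refine le_trans ?_ ((ENat.epow_right_mono (prime_ne_zero p) hxp).trans
    (prime_pow_valuation_le W p x))
  simp only [Nat.cast_one, ENat.epow_one]
  exact_mod_cast hp

/-! ### Events stable under truncation -/

/-- The event `T` is approximable if replacing `f`, `g` by `f' N`, `g' N` in the events `{f ∈ T}`,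
`{g ∈ T}` makes an arbitrarily small error for large `N`, uniformly along the sequence `ν`. -/
def Approximable {α β X : Type*} [MeasurableSpace α] [MeasurableSpace β] (ν : ℕ → Measure α)
    (P : Measure β) (f : α → X) (f' : ℕ → α → X) (g : β → X) (g' : ℕ → β → X) (T : Set X) : Prop :=
  ∀ ε : ℝ, 0 < ε → ∀ᶠ N in atTop,
    (∀ᶠ n in atTop, (ν n).real {a | ¬ (f a ∈ T ↔ f' N a ∈ T)} ≤ ε) ∧
      P.real {b | ¬ (g b ∈ T ↔ g' N b ∈ T)} ≤ ε

section

variable {α β X : Type*} [MeasurableSpace α] [MeasurableSpace β] {ν : ℕ → Measure α}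
  {P : Measure β} {f : α → X} {f' : ℕ → α → X} {g : β → X} {g' : ℕ → β → X} {T T' : Set X}

theorem Approximable.compl (h : Approximable ν P f f' g g' T) :
    Approximable ν P f f' g g' Tᶜ := by
  unfold Approximable
  simp only [Set.mem_compl_iff, not_iff_not]
  exact h

theorem Approximable.univ : Approximable ν P f f' g g' Set.univ := by
  intro ε hε
  simp [hε.le]

theorem measureReal_not_iff_inter_le (μ : Measure α) [IsProbabilityMeasure μ] (u v : α → X) :
    μ.real {a | ¬ (u a ∈ T ∩ T' ↔ v a ∈ T ∩ T')} ≤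
      μ.real {a | ¬ (u a ∈ T ↔ v a ∈ T)} + μ.real {a | ¬ (u a ∈ T' ↔ v a ∈ T')} := by
  refine (measureReal_mono fun a ha => ?_).trans (measureReal_union_le _ _)
  by_contra h
  simp only [Set.mem_union, Set.mem_ofPred_eq, not_or, not_not] at h
  exact ha (and_congr h.1 h.2)

theorem Approximable.inter [∀ n, IsProbabilityMeasure (ν n)] [IsProbabilityMeasure P]
    (h : Approximable ν P f f' g g' T) (h' : Approximable ν P f f' g g' T') :
    Approximable ν P f f' g g' (T ∩ T') := by
  intro ε hε
  filter_upwards [h (ε / 2) (half_pos hε), h' (ε / 2) (half_pos hε)] with N hN hN'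
  refine ⟨?_, ?_⟩
  · filter_upwards [hN.1, hN'.1] with n hn hn'
    linarith [measureReal_not_iff_inter_le (T := T) (T' := T') (ν n) f (f' N)]
  · linarith [measureReal_not_iff_inter_le (T := T) (T' := T') P g (g' N), hN.2, hN'.2]

theorem abs_measureReal_sub_le (μ : Measure α) [IsProbabilityMeasure μ] (u v : α → X) :
    |μ.real {a | u a ∈ T} - μ.real {a | v a ∈ T}| ≤ μ.real {a | ¬ (u a ∈ T ↔ v a ∈ T)} := by
  have h1 : μ.real {a | u a ∈ T} ≤ μ.real {a | v a ∈ T} + μ.real {a | ¬ (u a ∈ T ↔ v a ∈ T)} := by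
    refine (measureReal_mono fun a ha => ?_).trans (measureReal_union_le _ _)
    by_cases hv : v a ∈ T
    · exact Or.inl hv
    · exact Or.inr fun h => hv (h.1 ha)
  have h2 : μ.real {a | v a ∈ T} ≤ μ.real {a | u a ∈ T} + μ.real {a | ¬ (u a ∈ T ↔ v a ∈ T)} := by
    refine (measureReal_mono fun a ha => ?_).trans (measureReal_union_le _ _)
    by_cases hu : u a ∈ T
    · exact Or.inl hu
    · exact Or.inr fun h => hu (h.2 ha)
  rw [abs_le]
  constructor <;> linarith

theorem Approximable.tendsto [∀ n, IsProbabilityMeasure (ν n)] [IsProbabilityMeasure P]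
    (h : Approximable ν P f f' g g' T)
    (hlim : ∀ N, Tendsto (fun n => (ν n).real {a | f' N a ∈ T}) atTop
      (𝓝 (P.real {b | g' N b ∈ T}))) :
    Tendsto (fun n => (ν n).real {a | f a ∈ T}) atTop (𝓝 (P.real {b | g b ∈ T})) := by
  rw [Metric.tendsto_nhds]
  intro ε hε
  obtain ⟨N, hN, hN'⟩ := (h (ε / 4) (by positivity)).exists
  filter_upwards [hN, Metric.tendsto_nhds.1 (hlim N) (ε / 4) (by positivity)] with n hn hn'
  rw [Real.dist_eq] at hn' ⊢
  have h1 := (abs_measureReal_sub_le (T := T) (ν n) f (f' N)).trans hn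
  have h2 := (abs_measureReal_sub_le (T := T) P g (g' N)).trans hN'
  rw [abs_le] at h1 h2
  rw [abs_lt] at hn' ⊢
  constructor <;> linarith [hn'.1, hn'.2, h1.1, h1.2, h2.1, h2.2]

end

/-! ### Weak convergence on labellings by `ℕ∞` -/

theorem isOpen_natCast_le (a : ℕ) : IsOpen {v : ℕ∞ | (a : ℕ∞) ≤ v} := by
  obtain _ | a := a
  · simp
  · have : {v : ℕ∞ | ((a + 1 : ℕ) : ℕ∞) ≤ v} = Set.Ioi (a : ℕ∞) := by
      ext v
      simp only [Set.mem_ofPred_eq, Set.mem_Ioi, Nat.cast_add, Nat.cast_one]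
      exact ENat.add_one_le_iff (ENat.natCast_ne_top a)
    rw [this]
    exact isOpen_Ioi

/-- To prove weak convergence of laws of labellings by `ℕ∞` it is enough to consider the events in
a class of sets stable under intersections and complements and containing the events `{a ≤ ω x}`. -/
theorem tendsto_of_forall_le_mem {d : ℕ} {𝒯 : Set (Config d ℕ∞) → Prop} (huniv : 𝒯 Set.univ)
    (hcompl : ∀ T, 𝒯 T → 𝒯 Tᶜ) (hinter : ∀ T T', 𝒯 T → 𝒯 T' → 𝒯 (T ∩ T'))
    (hle : ∀ (a : ℕ) (x : Fin d → ℤ), 𝒯 {ω | (a : ℕ∞) ≤ ω x})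
    {μ : ℕ → ProbabilityMeasure (Config d ℕ∞)} {μ' : ProbabilityMeasure (Config d ℕ∞)}
    (hμ : ∀ T, MeasurableSet T → 𝒯 T →
      Tendsto (fun n => (μ n : Measure (Config d ℕ∞)).real T) atTop
        (𝓝 ((μ' : Measure (Config d ℕ∞)).real T))) :
    Tendsto μ atTop (𝓝 μ') := by
  have hmeasle : ∀ (a : ℕ) (x : Fin d → ℤ), MeasurableSet {ω : Config d ℕ∞ | (a : ℕ∞) ≤ ω x} :=
    fun a x => (MeasurableSet.of_discrete (s := {v : ℕ∞ | (a : ℕ∞) ≤ v})).preimage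
      (measurable_pi_apply x)
  have hpi : IsPiSystem {T : Set (Config d ℕ∞) | MeasurableSet T ∧ 𝒯 T} :=
    fun T hT T' hT' _ => ⟨hT.1.inter hT'.1, hinter _ _ hT.2 hT'.2⟩
  refine hpi.tendsto_probabilityMeasure_of_tendsto_of_mem (fun T hT => hT.1) ?_ ?_
  · intro u hu ω hω
    obtain ⟨I, U, hU, hIU⟩ := isOpen_pi_iff.1 hu ω hω
    have hC : ∀ x ∈ I, ∃ C : Set ℕ∞, C ∈ 𝓝 (ω x) ∧ C ⊆ U x ∧ 𝒯 {ω' | ω' x ∈ C} := by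
      intro x hx
      obtain ⟨hUo, hUx⟩ := hU x hx
      -- Neighbourhoods in `ℕ∞`: tails `{a + 1 ≤ v}` at infinity, and at a finite `a` the singleton,
      -- which is `{a ≤ v}` minus `{a + 1 ≤ v}`.
      by_cases htop : ω x = ⊤
      · rw [htop] at hUx ⊢
        obtain ⟨v, hv, hvU⟩ := nhds_top_basis.mem_iff.1 (hUo.mem_nhds hUx)
        obtain ⟨a, rfl⟩ := ENat.ne_top_iff_exists.1 hv.ne
        refine ⟨{v | ((a + 1 : ℕ) : ℕ∞) ≤ v}, (isOpen_natCast_le _).mem_nhds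
          (le_top : ((a + 1 : ℕ) : ℕ∞) ≤ ⊤), ?_,
          hle _ x⟩
        intro w hw
        have ha : (a : ℕ∞) < ((a + 1 : ℕ) : ℕ∞) := by exact_mod_cast a.lt_succ_self
        exact hvU (ha.trans_le hw)
      · obtain ⟨a, ha⟩ := ENat.ne_top_iff_exists.1 htop
        refine ⟨{ω x}, (ENat.isOpen_singleton htop).mem_nhds rfl, by simpa using hUx, ?_⟩
        have : {ω' : Config d ℕ∞ | ω' x ∈ ({ω x} : Set ℕ∞)} =
            {ω' | (a : ℕ∞) ≤ ω' x} ∩ {ω' | ((a + 1 : ℕ) : ℕ∞) ≤ ω' x}ᶜ := by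
          ext ω'
          simp only [Set.mem_singleton_iff, Set.mem_inter_iff, Set.mem_ofPred_eq,
            Set.mem_compl_iff, not_le, Nat.cast_add, Nat.cast_one]
          rw [ENat.lt_add_one_iff (ENat.natCast_ne_top a), ← ha]
          exact ⟨fun h => ⟨h.ge, h.le⟩, fun h => le_antisymm h.2 h.1⟩
        rw [this]
        exact hinter _ _ (hle _ _) (hcompl _ (hle _ _))
    choose! C hCn hCU hCT using hC
    refine ⟨(I : Set (Fin d → ℤ)).pi C, ⟨?_, ?_⟩, ?_, (Set.pi_mono fun x hx => hCU x hx).trans hIU⟩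
    · exact MeasurableSet.pi I.countable_toSet fun x _ => MeasurableSet.of_discrete
    · clear hIU hU
      have hstep : ∀ J : Finset (Fin d → ℤ), J ⊆ I → 𝒯 ((J : Set (Fin d → ℤ)).pi C) := by
        classical
        intro J
        induction J using Finset.induction_on with
        | empty => intro _; simpa using huniv
        | insert x J _ ih =>
          intro hJ
          rw [Finset.coe_insert, Set.insert_pi]
          exact hinter _ _ (hCT x (hJ (Finset.mem_insert_self x J)))
            (ih ((Finset.subset_insert x J).trans hJ))
      exact hstep I subset_rfl
    · exact set_pi_mem_nhds I.finite_toSet fun x hx => hCn x hx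
  · intro T hT
    have := hμ T hT.1 hT.2
    rw [← NNReal.tendsto_coe]
    exact this

/-! ### Tightness of the gcd -/

/-- The vectors of `ℤ^k` in the box of size `M` all of whose coordinates are divisible by `q`. -/
def boxMultiples (k M q : ℕ) : Finset (Fin k → ℤ) :=
  (Fintype.piFinset fun _ : Fin k => Finset.Icc (-((M / q : ℕ) : ℤ)) (M / q : ℕ)).image
    fun b => (q : ℤ) • b

theorem mem_boxMultiples {M q : ℕ} (hq : 0 < q) {c : Fin k → ℤ}
    (hM : ∀ j, |c j| ≤ M) (hc : ∀ j, (q : ℤ) ∣ c j) : c ∈ boxMultiples k M q := by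
  obtain ⟨b, rfl⟩ := forall_dvd_iff.1 hc
  refine Finset.mem_image.2 ⟨b, Fintype.mem_piFinset.2 fun j => ?_, rfl⟩
  have h := hM j
  rw [Pi.smul_apply, smul_eq_mul, abs_mul, Nat.abs_cast] at h
  have hq' : (0 : ℤ) < q := by exact_mod_cast hq
  rw [Finset.mem_Icc, ← abs_le, Int.natCast_div, Int.le_ediv_iff_mul_le hq']
  linarith

/-- Since `q ≤ M`, the quotient `M / q` is at least `1`, so `2 (M / q) + 1 ≤ 3 (M / q)`. -/
theorem card_boxMultiples_le {M q : ℕ} (hq : 0 < q) (hqM : q ≤ M) :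
    ((boxMultiples k M q).card : ℝ) ≤ (3 * M) ^ k * ((q : ℝ) ^ k)⁻¹ := by
  have h1 : (boxMultiples k M q).card ≤ (2 * (M / q) + 1) ^ k := by
    refine Finset.card_image_le.trans ?_
    rw [Fintype.card_piFinset_const, Int.card_Icc]
    refine Nat.pow_le_pow_left ?_ _
    omega
  have h2 : 1 ≤ M / q := (Nat.one_le_div_iff hq).2 hqM
  have h3 : (boxMultiples k M q).card ≤ (3 * (M / q)) ^ k :=
    h1.trans (Nat.pow_le_pow_left (by omega) _)
  have h4 : ((M / q : ℕ) : ℝ) ≤ M / q := Nat.cast_div_le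
  calc ((boxMultiples k M q).card : ℝ) ≤ (3 * ((M / q : ℕ) : ℝ)) ^ k := by exact_mod_cast h3
    _ ≤ (3 * (M / q)) ^ k := by gcongr
    _ = (3 * M) ^ k * ((q : ℝ) ^ k)⁻¹ := by rw [← mul_div_assoc, div_pow, div_eq_mul_inv]

/-- A union bound over the value `q` of the gcd, which is at most `M` because some coordinate is
nonzero. As `k ≥ 2`, `q ^ (-k) ≤ q ^ (-2)`, whose sum over `q > Q` is at most `1 / Q`. -/
theorem ncard_box_gcd_gt_le (hk : 2 ≤ k) {M Q : ℕ} (hQ : Q ≠ 0) {A : Set (Fin k → ℤ)}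
    (hA : ∀ c ∈ A, (∀ j, |c j| ≤ M) ∧ Q < gcdCoord c) :
    (A.ncard : ℝ) ≤ (3 * M) ^ k / Q := by
  have hsub : A ⊆ ((Finset.Ioc Q M).biUnion fun q => boxMultiples k M q : Finset (Fin k → ℤ)) := by
    intro c hc
    obtain ⟨hcM, hcQ⟩ := hA c hc
    have hne : gcdCoord c ≠ 0 := by omega
    obtain ⟨j, hj⟩ := Function.ne_iff.1 (gcdCoord_eq_zero_iff.not.1 hne)
    have hdvd := dvd_gcdCoord_iff.1 (dvd_refl (gcdCoord c))
    have hle : (gcdCoord c : ℤ) ≤ M :=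
      (Int.le_of_dvd (abs_pos.2 hj) ((dvd_abs _ _).2 (hdvd j))).trans (hcM j)
    simp only [Finset.coe_biUnion, Set.mem_iUnion]
    exact ⟨gcdCoord c, Finset.mem_Ioc.2 ⟨hcQ, by exact_mod_cast hle⟩,
      mem_boxMultiples (Nat.pos_of_ne_zero hne) hcM hdvd⟩
  have h1 : A.ncard ≤ ∑ q ∈ Finset.Ioc Q M, (boxMultiples k M q).card := by
    refine (Set.ncard_le_ncard hsub (Finset.finite_toSet _)).trans ?_
    rw [Set.ncard_coe_finset]
    exact Finset.card_biUnion_le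
  have h2 : ∑ q ∈ Finset.Ioc Q M, ((q : ℝ) ^ 2)⁻¹ ≤ (Q : ℝ)⁻¹ := by
    obtain h | h := le_total Q M
    · exact (sum_Ioc_inv_sq_le_sub hQ h).trans (sub_le_self _ (by positivity))
    · rw [Finset.Ioc_eq_empty (by omega), Finset.sum_empty]
      positivity
  calc (A.ncard : ℝ) ≤ ∑ q ∈ Finset.Ioc Q M, ((boxMultiples k M q).card : ℝ) := by exact_mod_cast h1
    _ ≤ ∑ q ∈ Finset.Ioc Q M, (3 * M : ℝ) ^ k * ((q : ℝ) ^ 2)⁻¹ := by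
      refine Finset.sum_le_sum fun q hq => ?_
      obtain ⟨hq1, hq2⟩ := Finset.mem_Ioc.1 hq
      have hq0 : 0 < q := by omega
      refine (card_boxMultiples_le hq0 hq2).trans ?_
      have hq1' : (1 : ℝ) ≤ q := by exact_mod_cast hq0
      gcongr
    _ ≤ (3 * M : ℝ) ^ k * (Q : ℝ)⁻¹ := by
      rw [← Finset.mul_sum]
      gcongr
    _ = _ := (div_eq_mul_inv _ _).symm

theorem Chart.gcdCoord_π (e : Chart Γ k) {z : Fin d → ℤ} (hz : z ∈ Γ) :
    gcdCoord (e.π z) = gcdCoord z :=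
  Nat.dvd_antisymm
    (dvd_gcdCoord_iff.2 ((e.dvd_π_iff hz).1 (dvd_gcdCoord_iff.1 dvd_rfl)))
    (dvd_gcdCoord_iff.2 ((e.dvd_π_iff hz).2 (dvd_gcdCoord_iff.1 dvd_rfl)))

theorem uniformOn_real_mono {S A B : Set (Fin d → ℤ)} (hS : S.Finite)
    (h : ∀ y ∈ S, y ∈ A → y ∈ B) : (uniformOn S).real A ≤ (uniformOn S).real B := by
  rw [uniformOn_real hS, uniformOn_real hS]
  have hsub : S ∩ A ⊆ S ∩ B := fun y hy => ⟨hy.1, h y hy.1 hy.2⟩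
  have := Set.ncard_le_ncard hsub (hS.inter_of_left B)
  gcongr

/-- The gcd of `x + Y`, for `Y` uniform in `S n`, is bounded in probability. -/
def TightAt (S : ℕ → Set (Fin d → ℤ)) (x : Fin d → ℤ) : Prop :=
  ∀ ε : ℝ, 0 < ε → ∃ Q : ℕ, ∀ᶠ n in atTop, (uniformOn (S n)).real {y | Q < gcdCoord (x + y)} ≤ ε

theorem tightAt_of_mem (e : Chart Γ k) (hk : 2 ≤ k) {S : ℕ → Set (Fin d → ℤ)} (hS : IsFolner Γ S)
    {x : Fin d → ℤ} (hx : x ∈ Γ) {b : ℕ → ℕ} {C : ℕ}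
    (hC : ∀ n, ∀ y ∈ S n, ∀ j, |e.π (x + y) j| ≤ ((C * b n : ℕ) : ℤ))
    {c : ℝ} (hc : 0 < c) (hcard : ∀ᶠ n in atTop, c * (b n : ℝ) ^ k ≤ (S n).ncard) :
    TightAt S x := by
  intro ε hε
  -- Chosen so that `(3 C b)^k / Q ≤ ε c b^k`, the right side being at most `ε |S n|`.
  obtain ⟨Q, hQ⟩ := exists_nat_gt ((3 * C : ℝ) ^ k / (c * ε))
  have hQ0 : (0 : ℝ) < Q := lt_of_le_of_lt (by positivity) hQ
  refine ⟨Q, ?_⟩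
  filter_upwards [hcard] with n hn
  have hpos : (0 : ℝ) < (S n).ncard := by
    exact_mod_cast (Set.ncard_pos (hS.finite n)).2 (hS.nonempty n)
  rw [uniformOn_real (hS.finite n), div_le_iff₀ hpos]
  set A := S n ∩ {y | Q < gcdCoord (x + y)}
  have hinj : Set.InjOn (fun y => e.π (x + y)) A := by
    intro y hy z hz hyz
    have hy' := (e.mem_iff _).1 (Γ.add_mem hx (hS.subset n hy.1))
    have hz' := (e.mem_iff _).1 (Γ.add_mem hx (hS.subset n hz.1))
    exact add_left_cancel (hy'.symm.trans ((congrArg e.ι hyz).trans hz'))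
  have hle := ncard_box_gcd_gt_le hk (M := C * b n) (Q := Q) (by exact_mod_cast hQ0.ne')
    (A := (fun y => e.π (x + y)) '' A) (by
      rintro _ ⟨y, hy, rfl⟩
      refine ⟨hC n y hy.1, ?_⟩
      rw [e.gcdCoord_π (Γ.add_mem hx (hS.subset n hy.1))]
      exact hy.2)
  rw [hinj.ncard_image] at hle
  refine hle.trans ?_
  rw [div_lt_iff₀ (by positivity)] at hQ
  rw [div_le_iff₀ hQ0]
  calc (3 * ((C * b n : ℕ) : ℝ)) ^ k = (3 * C : ℝ) ^ k * (b n : ℝ) ^ k := by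
        push_cast
        rw [← mul_pow, mul_assoc]
    _ ≤ (Q * (c * ε)) * (b n : ℝ) ^ k := by gcongr
    _ = ε * (c * (b n : ℝ) ^ k) * Q := by ring
    _ ≤ ε * (S n).ncard * Q := by gcongr

/-- The map `id - ι ∘ π` kills `y ∈ Γ` and preserves divisibility, so the gcd of `x + y` divides the
fixed nonzero vector `x - ι (π x)`. -/
theorem tightAt_of_notMem (e : Chart Γ k) {S : ℕ → Set (Fin d → ℤ)} (hS : IsFolner Γ S)
    {x : Fin d → ℤ} (hx : x ∉ Γ) : TightAt S x := by
  intro ε hε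
  have hne : gcdCoord (x - e.ι (e.π x)) ≠ 0 := by
    rw [Ne, gcdCoord_eq_zero_iff, sub_eq_zero]
    exact fun h => hx ((e.mem_iff x).2 h.symm)
  refine ⟨gcdCoord (x - e.ι (e.π x)), Eventually.of_forall fun n => ?_⟩
  refine (uniformOn_real_mono (B := ∅) (hS.finite n) fun y hy hlt => ?_).trans
    (by rw [measureReal_empty]; exact hε.le)
  refine absurd (Nat.le_of_dvd (Nat.pos_of_ne_zero hne) (dvd_gcdCoord_iff.2 fun i => ?_))
    (not_le.2 hlt)
  have h1 := dvd_gcdCoord_iff.1 (dvd_refl (gcdCoord (x + y)))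
  have h2 : x - e.ι (e.π x) = (x + y) - e.ι (e.π (x + y)) := by
    rw [map_add, map_add, (e.mem_iff y).1 (hS.subset n hy)]
    abel
  rw [h2]
  exact dvd_sub (h1 i) (forall_dvd_map e.ι (forall_dvd_map e.π h1) i)

theorem tendsto_uniformOn_add_eq_zero {S : ℕ → Set (Fin d → ℤ)} (hfin : ∀ n, (S n).Finite)
    (hcard : Tendsto (fun n => ((S n).ncard : ℝ)) atTop atTop) (x : Fin d → ℤ) :
    Tendsto (fun n => (uniformOn (S n)).real {y | x + y = 0}) atTop (𝓝 0) := by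
  refine squeeze_zero (fun n => measureReal_nonneg) (fun n => ?_) hcard.inv_tendsto_atTop
  rw [uniformOn_real (hfin n), Pi.inv_apply, ← one_div]
  gcongr
  have h : S n ∩ {y | x + y = 0} ⊆ {-x} := fun y hy => (neg_eq_of_add_eq_zero_right hy.2).symm
  have := Set.ncard_le_ncard h
  rw [Set.ncard_singleton] at this
  exact_mod_cast this

/-! ### Removing the truncation -/

theorem measurable_truncProfile (N : ℕ) (x : Fin d → ℤ) :
    Measurable fun W : Chains Γ => truncProfile N W x :=
  Finset.measurable_prod _ fun p _ =>
    (Measurable.of_discrete (f := fun v : ℕ∞ => ((p : ℕ) : ℕ∞) ^ min v N)).comp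
      (measurable_valuation Γ p x)

theorem measurable_valuationProd (x : Fin d → ℤ) :
    Measurable fun W : Chains Γ => valuationProd W x :=
  Measurable.iSup fun s => Finset.measurable_prod s fun p _ =>
    (Measurable.of_discrete (f := fun v : ℕ∞ => ((p : ℕ) : ℕ∞) ^ v)).comp
      (measurable_valuation Γ p x)

/-- These events decrease in `N` and have empty intersection by `exists_le_truncProfile`. -/
theorem tendsto_measure_truncProfile_lt (a : ℕ) (x : Fin d → ℤ) :
    Tendsto (fun N => (chainsLaw Γ).real
      {W | (a : ℕ∞) ≤ valuationProd W x ∧ ¬ (a : ℕ∞) ≤ truncProfile N W x}) atTop (𝓝 0) := by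
  have h := tendsto_measure_iInter_atTop (μ := chainsLaw Γ)
    (s := fun N => {W | (a : ℕ∞) ≤ valuationProd W x ∧ ¬ (a : ℕ∞) ≤ truncProfile N W x})
    (fun N => ?_) ?_ ⟨0, measure_ne_top _ _⟩
  · have hempty : ⋂ N, {W : Chains Γ | (a : ℕ∞) ≤ valuationProd W x ∧
        ¬ (a : ℕ∞) ≤ truncProfile N W x} = ∅ := by
      refine Set.eq_empty_of_forall_notMem fun W hW => ?_
      rw [Set.mem_iInter] at hW
      obtain ⟨N, hN⟩ := exists_le_truncProfile (hW 0).1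
      exact (hW N).2 hN
    rw [hempty, measure_empty] at h
    exact (ENNReal.tendsto_toReal ENNReal.zero_ne_top).comp h
  · refine (MeasurableSet.inter ?_ (MeasurableSet.compl ?_)).nullMeasurableSet
    · exact (MeasurableSet.of_discrete (s := {v : ℕ∞ | (a : ℕ∞) ≤ v})).preimage
        (measurable_valuationProd x)
    · exact (MeasurableSet.of_discrete (s := {v : ℕ∞ | (a : ℕ∞) ≤ v})).preimage
        (measurable_truncProfile N x)
  · intro M N hMN W hW
    exact ⟨hW.1, fun h => hW.2 (h.trans (truncProfile_mono W x hMN))⟩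

/-- Truncation only lowers the product. The exceptional point `y = -x`, where the label is `0` by
convention, is negligible because `|S n| → ∞`. -/
theorem approximable_natCast_le (e : Chart Γ k) (hk : 1 ≤ k) {S : ℕ → Set (Fin d → ℤ)}
    (hS : IsFolner Γ S) (hcard : Tendsto (fun n => ((S n).ncard : ℝ)) atTop atTop)
    {x : Fin d → ℤ} (hx : TightAt S x ∨ ∀ a : ℕ, ∀ᵐ W ∂chainsLaw Γ, (a : ℕ∞) ≤ valuationProd W x)
    (a : ℕ) :
    Approximable (fun n => uniformOn (S n)) (chainsLaw Γ) (fun y => gcdProfile (chainAt (e.proj y)))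
      (fun N y => truncProfile N (chainAt (e.proj y))) gcdProfile truncProfile
      {ω | (a : ℕ∞) ≤ ω x} := by
  have hlim := tendsto_measure_truncProfile_lt (Γ := Γ) a x
  have hP : ∀ N, (chainsLaw Γ).real {W | ¬ (gcdProfile W ∈ {ω : Config d ℕ∞ | (a : ℕ∞) ≤ ω x} ↔
      truncProfile N W ∈ {ω : Config d ℕ∞ | (a : ℕ∞) ≤ ω x})} =
      (chainsLaw Γ).real {W | (a : ℕ∞) ≤ valuationProd W x ∧ ¬ (a : ℕ∞) ≤ truncProfile N W x} := by
    intro N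
    refine measureReal_congr ?_
    filter_upwards [ae_exists_valuation_ne_top e hk x] with W hW
    refine propext ?_
    change ¬ (_ ≤ gcdProfile W x ↔ _ ≤ truncProfile N W x) ↔ _ ≤ _ ∧ ¬ _ ≤ _
    rw [gcdProfile_eq_valuationProd hW]
    have : (a : ℕ∞) ≤ truncProfile N W x → (a : ℕ∞) ≤ valuationProd W x :=
      fun h => h.trans (truncProfile_le_valuationProd N W x)
    tauto
  have hY : ∀ n, ∀ y ∈ S n, (e.proj y : Fin d → ℤ) = y := fun n y hy => e.coe_proj (hS.subset n hy)
  have hzero := tendsto_uniformOn_add_eq_zero hS.finite hcard x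
  intro ε hε
  have hPε : ∀ᶠ N in atTop, (chainsLaw Γ).real
      {W | (a : ℕ∞) ≤ valuationProd W x ∧ ¬ (a : ℕ∞) ≤ truncProfile N W x} ≤ ε :=
    (hlim.eventually_lt_const hε).mono fun _ => le_of_lt
  refine Eventually.and ?_ (by simpa only [hP] using hPε)
  obtain hx | hx := hx
  -- Tight case: when `0 < gcd ≤ Q < N`, the truncation is exact.
  · obtain ⟨Q, hQ⟩ := hx (ε / 2) (half_pos hε)
    filter_upwards [eventually_gt_atTop Q] with N hN
    filter_upwards [hQ, hzero.eventually_lt_const (half_pos hε)] with n hn hn'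
    have := hS.isProbabilityMeasure n
    refine (uniformOn_real_mono (B := {y | x + y = 0} ∪ {y | Q < gcdCoord (x + y)}) (hS.finite n)
      fun y hy hbad => ?_).trans ((measureReal_union_le _ _).trans (by linarith))
    by_contra hcon
    simp only [Set.mem_union, Set.mem_ofPred_eq, not_or, not_lt] at hcon
    refine hbad ?_
    have hg : gcdCoord (x + (e.proj y).1) ≠ 0 := by
      rw [hY n y hy]
      exact gcdCoord_eq_zero_iff.not.2 hcon.1
    rw [truncProfile_eq_valuationProd, valuationProd_chainAt hg, gcdProfile_chainAt_apply]
    rw [valuationProd_chainAt hg, hY n y hy]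
    exact_mod_cast hcon.2.trans_lt hN
  -- Infinite case: for large `N` the random truncated product is at least `a` with high
  -- probability. For that fixed `N` this passes to large `n`, where the gcd dominates the truncated
  -- product.
  · have hx' : ∀ N, (chainsLaw Γ).real {W | (a : ℕ∞) ≤ valuationProd W x ∧
        ¬ (a : ℕ∞) ≤ truncProfile N W x} =
        (chainsLaw Γ).real {W | truncProfile N W ∈ {ω : Config d ℕ∞ | (a : ℕ∞) ≤ ω x}ᶜ} := by
      intro N
      refine measureReal_congr ?_
      filter_upwards [hx a] with W hW
      exact propext (and_iff_right hW)
    simp only [hx'] at hlim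
    filter_upwards [hlim.eventually_lt_const (half_pos hε)] with N hN
    filter_upwards [(hS.tendsto_truncProfile e N _).eventually_lt_const hN,
      hzero.eventually_lt_const (half_pos hε)] with n hn hn'
    have := hS.isProbabilityMeasure n
    refine (uniformOn_real_mono (B := {y | x + y = 0} ∪ {y | truncProfile N (chainAt (e.proj y)) ∈
      {ω : Config d ℕ∞ | (a : ℕ∞) ≤ ω x}ᶜ}) (hS.finite n)
      fun y hy hbad => ?_).trans ((measureReal_union_le _ _).trans (by linarith))
    by_contra hcon
    simp only [Set.mem_union, Set.mem_ofPred_eq, Set.mem_compl_iff, not_or, not_not] at hcon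
    refine hbad ?_
    have hg : gcdCoord (x + (e.proj y).1) ≠ 0 := by
      rw [hY n y hy]
      exact gcdCoord_eq_zero_iff.not.2 hcon.1
    refine iff_of_true ?_ hcon.2
    rw [gcdProfile_chainAt_apply, ← valuationProd_chainAt hg]
    exact hcon.2.trans (truncProfile_le_valuationProd _ _ _)

theorem Chart.exists_bound (e : Chart Γ k) {F : Set (Fin d → ℝ)} (hF : Bornology.IsBounded F)
    (x : Fin d → ℤ) : ∃ C : ℕ, ∀ m : ℕ, 1 ≤ m → ∀ y ∈ dilate Γ F (m : ℝ), ∀ j,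
      |e.π (x + y) j| ≤ ((C * m : ℕ) : ℤ) := by
  obtain ⟨R, hR⟩ := hF.exists_norm_le
  obtain ⟨B, hB⟩ := exists_nat_ge (‖toReal x‖ + R)
  -- `C` is `B` times the sum of the absolute values of the matrix entries of `π`; `m ≥ 1` lets `B *
  -- m` absorb the shift by `x`.
  refine ⟨∑ i, B * ∑ j, (e.π (Pi.single i 1) j).natAbs, fun m hm y hy j => ?_⟩
  have hm' : (1 : ℝ) ≤ m := by exact_mod_cast hm
  have hz : ∀ i, |(x + y) i| ≤ ((B * m : ℕ) : ℤ) := by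
    intro i
    have h1 : |((m : ℝ)⁻¹ * (y i : ℝ))| ≤ R :=
      (norm_le_pi_norm ((m : ℝ)⁻¹ • toReal y) i).trans (hR _ hy.2)
    have h2 : |(x i : ℝ)| ≤ ‖toReal x‖ := norm_le_pi_norm (toReal x) i
    rw [abs_mul, abs_inv, Nat.abs_cast, inv_mul_le_iff₀ (by positivity)] at h1
    have h3 : |((x i : ℝ) + y i)| ≤ (B : ℝ) * m := by
      calc |((x i : ℝ) + y i)| ≤ |(x i : ℝ)| + |(y i : ℝ)| := abs_add_le _ _
        _ ≤ ‖toReal x‖ * m + m * R := by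
          gcongr
          exact h2.trans (le_mul_of_one_le_right (norm_nonneg _) hm')
        _ = (‖toReal x‖ + R) * m := by ring
        _ ≤ B * m := by gcongr
    exact_mod_cast h3
  rw [LinearMap.pi_apply_eq_sum_univ e.π (x + y), Finset.sum_apply]
  refine (Finset.abs_sum_le_sum_abs _ _).trans ?_
  push_cast
  rw [Finset.sum_mul]
  refine Finset.sum_le_sum fun i _ => ?_
  have h4 : |e.π (Pi.single i 1) j| ≤ ∑ j, |e.π (Pi.single i 1) j| :=
    Finset.single_le_sum (f := fun j => |e.π (Pi.single i 1) j|) (fun _ _ => abs_nonneg _)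
      (Finset.mem_univ j)
  rw [Pi.smul_apply, smul_eq_mul, abs_mul]
  have h5 := hz i
  push_cast at h5
  have h6 : (fun j => if i = j then (1 : ℤ) else 0) = Pi.single i 1 := by
    funext l
    simp [Pi.single_apply, eq_comm]
  rw [h6]
  calc |(x + y) i| * |e.π (Pi.single i 1) j|
      ≤ (B * m) * ∑ j, |e.π (Pi.single i 1) j| := by
        refine mul_le_mul h5 h4 (abs_nonneg _) (by positivity)
    _ = _ := by ring

theorem viewMeasure_real {F : Set (Fin d → ℤ)} (hfin : F.Finite) (hne : F.Nonempty)
    {c : Config d ℕ∞} {T : Set (Config d ℕ∞)} (hT : MeasurableSet T) :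
    (viewMeasure F hfin hne c : Measure (Config d ℕ∞)).real T =
      (uniformOn F).real {y | shift (-y) c ∈ T} :=
  map_measureReal_apply (measurable_of_countable _) hT

end GcdView

end

/-! ### Conclusion -/

theorem mainTheorem8 (d k : ℕ) (hk : 1 ≤ k) (Γ : AddSubgroup (Fin d → ℤ))
    (hΓ : Maximal (fun H : AddSubgroup (Fin d → ℤ) => Module.finrank ℤ H = k) Γ)
    (F : Set (Fin d → ℝ)) (hFbdd : Bornology.IsBounded F)
    (hFspan : F ⊆ (GcdView.realSpan Γ : Set (Fin d → ℝ)))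
    (hlim : ∃ ℓ : ℝ, ℓ ≠ 0 ∧
      Tendsto (fun r : ℝ => ((GcdView.dilate Γ F r).ncard : ℝ) / r ^ k) atTop (𝓝 ℓ))
    (n₀ : ℕ) (hn₀ : 1 ≤ n₀)
    (hFol : GcdView.IsFolner Γ fun n : ℕ => GcdView.dilate Γ F ((n₀ + n : ℕ) : ℝ)) :
    Tendsto
      (fun n : ℕ => GcdView.viewMeasure (GcdView.dilate Γ F ((n₀ + n : ℕ) : ℝ))
        (hFol.finite n) (hFol.nonempty n) (GcdView.gcdInfty d))
      atTop (𝓝 (GcdView.limitMeasure Γ)) := by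
  obtain ⟨e⟩ := GcdView.exists_chart hΓ
  obtain ⟨ℓ, hℓ, hlim⟩ := hlim
  have hℓ0 : 0 < ℓ := by
    refine lt_of_le_of_ne (ge_of_tendsto hlim ?_) hℓ.symm
    filter_upwards [eventually_ge_atTop 0] with r hr
    positivity
  have hb : Tendsto (fun n : ℕ => ((n₀ + n : ℕ) : ℝ)) atTop atTop :=
    tendsto_natCast_atTop_atTop.comp (tendsto_atTop_mono (Nat.le_add_left · n₀) tendsto_id)
  have hcard : ∀ᶠ n : ℕ in atTop, ℓ / 2 * ((n₀ + n : ℕ) : ℝ) ^ k ≤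
      (GcdView.dilate Γ F ((n₀ + n : ℕ) : ℝ)).ncard := by
    filter_upwards [(hlim.comp hb).eventually_const_lt (half_lt_self hℓ0)] with n hn
    have hpos : (0 : ℝ) < ((n₀ + n : ℕ) : ℝ) := by
      have : 0 < n₀ + n := by omega
      exact_mod_cast this
    exact ((lt_div_iff₀ (pow_pos hpos k)).1 hn).le
  have hcard' : Tendsto (fun n : ℕ => ((GcdView.dilate Γ F ((n₀ + n : ℕ) : ℝ)).ncard : ℝ)) atTop
      atTop :=
    tendsto_atTop_mono' _ hcard (((tendsto_pow_atTop (by omega)).comp hb).const_mul_atTop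
      (half_pos hℓ0))
  have htight : ∀ x, GcdView.TightAt (fun n : ℕ => GcdView.dilate Γ F ((n₀ + n : ℕ) : ℝ)) x ∨
      ∀ a : ℕ, ∀ᵐ W ∂GcdView.chainsLaw Γ, (a : ℕ∞) ≤ GcdView.valuationProd W x := by
    intro x
    by_cases hx : x ∈ Γ
    · obtain rfl | hk2 := hk.eq_or_lt
      · exact Or.inr (GcdView.ae_natCast_le_valuationProd e hx)
      · obtain ⟨C, hC⟩ := e.exists_bound hFbdd x
        exact Or.inl (GcdView.tightAt_of_mem e hk2 hFol hx (b := fun n => n₀ + n)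
          (fun n y hy j => hC (n₀ + n) (by omega) y hy j) (half_pos hℓ0) hcard)
    · exact Or.inl (GcdView.tightAt_of_notMem e hFol hx)
  have := hFol.isProbabilityMeasure
  -- The class of test events is that of the approximable ones.
  refine GcdView.tendsto_of_forall_le_mem GcdView.Approximable.univ
    (fun T => GcdView.Approximable.compl) (fun T T' => GcdView.Approximable.inter)
    (fun a x => GcdView.approximable_natCast_le e hk hFol hcard' (htight x) a) ?_
  intro T hT happ
  have hconv := happ.tendsto fun N => hFol.tendsto_truncProfile e N T
  have hlimit : (GcdView.limitMeasure Γ : Measure (GcdView.Config d ℕ∞)).real T =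
      (GcdView.chainsLaw Γ).real {W | GcdView.gcdProfile W ∈ T} :=
    map_measureReal_apply (GcdView.measurable_gcdProfile Γ) hT
  rw [hlimit]
  refine hconv.congr fun n => ?_
  rw [GcdView.viewMeasure_real _ _ hT]
  -- `e.proj` serves only to define chains at every point of `ℤ^d`; it is the identity on `F_n ⊆ Γ`.
  have key : ∀ y ∈ GcdView.dilate Γ F ((n₀ + n : ℕ) : ℝ),
      GcdView.gcdProfile (GcdView.chainAt (e.proj y)) =
        GcdView.shift (-y) (GcdView.gcdInfty d) := by
    intro y hy
    rw [GcdView.gcdProfile_chainAt, AddSubgroup.coe_neg, e.coe_proj hy.1]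
  refine le_antisymm (GcdView.uniformOn_real_mono (hFol.finite n) fun y hy h => ?_)
    (GcdView.uniformOn_real_mono (hFol.finite n) fun y hy h => ?_)
  · change GcdView.shift (-y) (GcdView.gcdInfty d) ∈ T
    rw [← key y hy]
    exact h
  · change GcdView.gcdProfile (GcdView.chainAt (e.proj y)) ∈ T
    rw [key y hy]
    exact h
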